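/- Let $T, L > 0$ and let $\lambda \in C^0([0,T])$ satisfy $\lambda \ge 0$ and $\int_0^T \lambda(t)\,dt > L$. Then there exist constants $\delta > 0$ and $C > 0$, depending only on $T$, $L$ and $\lambda$, such that for every $y_0 \in C^1([0,L])$ with $\|y_0\|_{C^1([0,L])} \le \delta$ and every $\alpha > 0$ there exist boundary controls $v_l, v_r \in C^1([0,T])$ and functions $y, z \in C^1([0,T]\times[0,L])$, with $z(t,\cdot)\in C^2((0,L))$ for every $t\in(0,T)$, satisfying $$ \begin{cases} y_t + (\lambda(t) + z)\, y_x = 0 & \text{in } (0,T)\times(0,L),\\ z - \alpha^2 z_{xx} = y & \text{in } (0,T)\times(0,L),\\ y(\cdot,0) = z(\cdot,0) = v_l & \text{in } (0,T),\\ y(\cdot,L) = z(\cdot,L) = v_r & \text{in } (0,T),\\ y(0,\cdot) = y_0 & \text{in } (0,L),\\ y(T,\cdot) = 0 & \text{in } (0,L), \end{cases} $$ and $$ \|y\|_{C^1([0,T]\times[0,L])} \le C\,\|y_0\|_{C^1([0,L])}. $$ Here $\|f\|_{C^1([0,L])} = \sup|f| + \sup|f'|$ and $\|y\|_{C^1([0,T]\times[0,L])}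 = \sup|y| + \sup|y_t| + \sup|y_x|$, the suprema being over $[0,L]$ and $[0,T]\times[0,L]$ respectively. -/

import Mathlib

open Set

noncomputable section

/-- The `C^0` norm on `s`, for a function that is bounded on the nonempty set `s`. -/
def supNormOn {X : Type*} (s : Set X) (f : X → ℝ) : ℝ :=
  sSup ((fun p => |f p|) '' s)

/-- The norm of `C^1([0,L])`: `sup |f| + sup |f'|`, with one-sided derivatives at the endpoints. -/
def c1NormInterval (L : ℝ) (f : ℝ → ℝ) : ℝ :=
  supNormOn (Icc 0 L) f + supNormOn (Icc 0 L) (fun x => derivWithin f (Icc 0 L) x)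

/-- `u`, a function of `(t, x)`, is of class `C^1` on the closed rectangle `[0,T] × [0,L]`. -/
def IsC1Rect (T L : ℝ) (u : ℝ → ℝ → ℝ) : Prop :=
  ContDiffOn ℝ 1 (fun p : ℝ × ℝ => u p.1 p.2) (Icc 0 T ×ˢ Icc 0 L)

/-- The norm of `C^1([0,T] × [0,L])`: `sup |u| + sup |u_t| + sup |u_x|`, with one-sided partial
derivatives on the boundary of the rectangle. -/
def c1NormRect (T L : ℝ) (u : ℝ → ℝ → ℝ) : ℝ :=
  supNormOn (Icc 0 T ×ˢ Icc 0 L) (fun p : ℝ × ℝ => u p.1 p.2)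
    + supNormOn (Icc 0 T ×ˢ Icc 0 L)
        (fun p : ℝ × ℝ => derivWithin (fun s => u s p.2) (Icc 0 T) p.1)
    + supNormOn (Icc 0 T ×ˢ Icc 0 L)
        (fun p : ℝ × ℝ => derivWithin (u p.1) (Icc 0 L) p.2)

/-- `(y, z)` is a classical solution, of class `C^1` on `[0,T] × [0,L]`, of the system
`y_t + (lam + z) y_x = 0`, `z - α² z_xx = y` in `(0,T) × (0,L)`, with boundary controls
`y = z = vl` at `x = 0` and `y = z = vr` at `x = L`, initial state `y0` and final state `0`. -/
structure IsNullControlledState (T L α : ℝ) (lam : ℝ → ℝ) (y0 vl vr : ℝ → ℝ)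
    (y z : ℝ → ℝ → ℝ) : Prop where
  y_c1 : IsC1Rect T L y
  z_c1 : IsC1Rect T L z
  /-- the second derivative `z_xx` exists in the classical sense -/
  z_c2 : ∀ t ∈ Ioo 0 T, ContDiffOn ℝ 2 (z t) (Ioo 0 L)
  transport : ∀ t ∈ Ioo 0 T, ∀ x ∈ Ioo 0 L,
    deriv (fun s => y s x) t + (lam t + z t x) * deriv (y t) x = 0
  filter : ∀ t ∈ Ioo 0 T, ∀ x ∈ Ioo 0 L,
    z t x - α ^ 2 * deriv (deriv (z t)) x = y t x
  left_control : ∀ t ∈ Ioo 0 T, y t 0 = vl t ∧ z t 0 = vl t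
  right_control : ∀ t ∈ Ioo 0 T, y t L = vr t ∧ z t L = vr t
  initial : ∀ x ∈ Ioo 0 L, y 0 x = y0 x
  final : ∀ x ∈ Ioo 0 L, y T x = 0

end

open Set Filter Topology
open Real (sinh cosh)
open scoped BoundedContinuousFunction

/-! The boundary controls are simply the traces at `0` and `L` of a solution living on the whole
line, so it suffices to solve a transport problem on `ℝ`. Let `η = ∫ λ - L`. The datum `y0` is
extended to a `C^1` function `g` on `ℝ` that vanishes to the left of `-η/2`, and the state is `y(t,
x) = g(backFlow V t x)`, with `V` an extension of `λ + z`. When `b`, the bound on `g` and `g'`, is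
small, `V ≥ λ - 3b` with `3bT ≤ η/2`. Every characteristic then moves right by at least `L + η/2`
during `[0, T]`, so the points of `[0, L]` are reached from where `g` is zero.

The velocity depends on `y` through the filter `z - α² z'' = y`. Uniformity in `α` comes from the
maximum principle alone: `z` inherits the sup bound of `y` (`abs_helmholtz_le`), and also its
Lipschitz bound (`abs_helmholtz_sub_le`), by comparing `z` with its translates and using linear
barriers at the endpoints, where `z = y`. The extension of `z` outside `[0, L]` is an odd reflection
folded into `[0, L]`; it is `C^1`, at most triples the amplitude, and does not increase the bound on
the derivative.

On bounded states that are `1`-Lipschitz in space, the map sending `y` to `g ∘ backFlow V` is a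
contraction in the sup norm once `g'` is small (`exists_fixedPoint_transport`). No derivative of the
iterates is needed: `V` is `C^1` in space, hence `backFlow V` is jointly `C^1`
(`contDiff_backFlow`), and regularity of `y` and `z` follows after the fixed point is found. -/

/-! ### Differentiation of functions of two variables and of parametric integrals -/

/-- A function of two real variables with continuous partial derivatives is of class `C^1`. -/
theorem contDiff_one_of_partial {f f₁ f₂ : ℝ → ℝ → ℝ}
    (h₁ : ∀ t x, HasDerivAt (fun s => f s x) (f₁ t x) t)
    (h₂ : ∀ t x, HasDerivAt (f t) (f₂ t x) x)
    (c₁ : Continuous fun p : ℝ × ℝ => f₁ p.1 p.2) (c₂ : Continuous fun p : ℝ × ℝ => f₂ p.1 p.2) :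
    ContDiff ℝ 1 (fun p : ℝ × ℝ => f p.1 p.2) := by
  have e : ∀ g : ℝ → ℝ → ℝ, (Continuous fun p : ℝ × ℝ => g p.1 p.2) →
      Continuous (fun p : ℝ × ℝ => (ContinuousLinearMap.toSpanSingleton ℝ (g p.1 p.2))) :=
    fun g hg => (ContinuousLinearMap.toSpanSingletonCLE (𝕜 := ℝ) (E := ℝ)).continuous.comp hg
  refine contDiff_one_iff_hasFDerivAt.2
    ⟨fun p => (ContinuousLinearMap.toSpanSingleton ℝ (f₁ p.1 p.2)).coprod
      (ContinuousLinearMap.toSpanSingleton ℝ (f₂ p.1 p.2)), ?_, fun p => ?_⟩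
  · exact (e f₁ c₁).continuousLinearMapCoprod (e f₂ c₂)
  · exact (hasStrictFDerivAt_uncurry_coprod (f := f)
      (f₁ := fun t x => ContinuousLinearMap.toSpanSingleton ℝ (f₁ t x))
      (f₂ := fun t x => ContinuousLinearMap.toSpanSingleton ℝ (f₂ t x))
      (Eventually.of_forall fun v => (h₁ v.1 v.2).hasFDerivAt)
      (Eventually.of_forall fun v => (h₂ v.1 v.2).hasFDerivAt)
      (e f₁ c₁).continuousAt (e f₂ c₂).continuousAt).hasFDerivAt

theorem ContDiff.hasDerivAt_fst {f : ℝ → ℝ → ℝ} (hf : ContDiff ℝ 1 fun p : ℝ × ℝ => f p.1 p.2)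
    (t x : ℝ) : HasDerivAt (fun s => f s x) (fderiv ℝ (fun p : ℝ × ℝ => f p.1 p.2) (t, x) (1, 0)) t := by
  have h := (hf.differentiable one_ne_zero (t, x)).hasFDerivAt
  exact h.comp_hasDerivAt (f := fun s => (s, x)) t ((hasDerivAt_id t).prodMk (hasDerivAt_const t x))

/-- Differentiation with respect to a parameter under the integral sign. -/
theorem hasDerivAt_intervalIntegral_param {f f₁ : ℝ → ℝ → ℝ}
    (hf : Continuous fun p : ℝ × ℝ => f p.1 p.2) (hf₁ : Continuous fun p : ℝ × ℝ => f₁ p.1 p.2)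
    (h : ∀ t x, HasDerivAt (fun s => f s x) (f₁ t x) t) (a b t : ℝ) :
    HasDerivAt (fun s => ∫ x in a..b, f s x) (∫ x in a..b, f₁ t x) t := by
  obtain ⟨K, hK⟩ := ((isCompact_closedBall t 1).prod (isCompact_uIcc (a := a) (b := b))).exists_bound_of_continuousOn
    hf₁.continuousOn
  have c : ∀ g : ℝ → ℝ → ℝ, (Continuous fun p : ℝ × ℝ => g p.1 p.2) → ∀ s, Continuous (g s) :=
    fun g hg s => hg.comp (by fun_prop : Continuous fun x => (s, x))
  refine (intervalIntegral.hasDerivAt_integral_of_dominated_loc_of_deriv_le (bound := fun _ => K)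
    (Metric.closedBall_mem_nhds t one_pos)
    (Eventually.of_forall fun s => (c f hf s).aestronglyMeasurable)
    ((c f hf t).intervalIntegrable _ _) (c f₁ hf₁ t).aestronglyMeasurable
    (Eventually.of_forall fun x hx s hs => hK (s, x) ⟨hs, uIoc_subset_uIcc hx⟩)
    (by simp) (Eventually.of_forall fun x _ s _ => h s x)).2

/-- Primitives in the second variable of a `C^1` function, with a continuous weight, are `C^1`. -/
theorem contDiff_one_weighted_primitive {y : ℝ → ℝ → ℝ} {g : ℝ → ℝ} (hg : Continuous g)
    (hy : ContDiff ℝ 1 fun p : ℝ × ℝ => y p.1 p.2) :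
    ContDiff ℝ 1 (fun p : ℝ × ℝ => ∫ s in (0 : ℝ)..p.2, g s * y p.1 s) := by
  have hc := hy.continuous
  have hd : Continuous fun p : ℝ × ℝ => fderiv ℝ (fun p : ℝ × ℝ => y p.1 p.2) (p.1, p.2) (1, 0) :=
    (hy.continuous_fderiv one_ne_zero).clm_apply continuous_const
  have hd' : Continuous fun p : ℝ × ℝ =>
      g p.2 * fderiv ℝ (fun p : ℝ × ℝ => y p.1 p.2) (p.1, p.2) (1, 0) := by fun_prop
  refine contDiff_one_of_partial (f := fun t x => ∫ s in (0 : ℝ)..x, g s * y t s)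
    (f₁ := fun t x => ∫ s in (0 : ℝ)..x, g s * fderiv ℝ (fun p : ℝ × ℝ => y p.1 p.2) (t, s) (1, 0))
    (f₂ := fun t x => g x * y t x) (fun t x => ?_) (fun t x => ?_) ?_ ?_
  · exact hasDerivAt_intervalIntegral_param (f := fun t x => g x * y t x)
      (by fun_prop) hd' (fun t x => (hy.hasDerivAt_fst t x).const_mul _) 0 x t
  · have : Continuous fun s => g s * y t s :=
      hg.mul (hc.comp (by fun_prop : Continuous fun s : ℝ => (t, s)))
    exact this.integral_hasStrictDerivAt 0 x |>.hasDerivAt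
  · refine intervalIntegral.continuous_parametric_intervalIntegral_of_continuous
      (f := fun (p : ℝ × ℝ) s => g s * fderiv ℝ (fun p : ℝ × ℝ => y p.1 p.2) (p.1, s) (1, 0)) ?_ continuous_snd
    exact hd'.comp (by fun_prop : Continuous fun q : (ℝ × ℝ) × ℝ => (q.1.1, q.2))
  · fun_prop

/-! ### Maximum principle in one dimension -/

/-- At an interior local maximum the second derivative is nonpositive. -/
theorem IsLocalMax.second_deriv_nonpos {f f' f'' : ℝ → ℝ} {x : ℝ} (hf : ∀ x, HasDerivAt f (f' x) x)
    (hf' : ∀ x, HasDerivAt f' (f'' x) x) (h : IsLocalMax f x) : f'' x ≤ 0 := by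
  by_contra! hpos
  have hd : deriv f = f' := funext fun x => (hf x).deriv
  have hmin : IsLocalMin f x := isLocalMin_of_deriv_deriv_pos (by rwa [hd, (hf' x).deriv])
    -- A critical point with positive second derivative is also a local minimum, so `f` is constant
    -- near `x` and its second derivative is zero there.
    h.deriv_eq_zero (hf x).continuousAt
  have hev : f =ᶠ[𝓝 x] fun _ => f x := by
    filter_upwards [h, hmin] with z h1 h2 using le_antisymm h1 h2
  have h2 := hev.deriv.deriv.eq_of_nhds
  rw [hd, (hf' x).deriv] at h2
  simp at h2
  exact hpos.ne' h2

/-- Maximum principle for `f - κ f''`. -/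
theorem le_of_sub_mul_second_deriv_le {f f' f'' : ℝ → ℝ} {κ a b c : ℝ} (hκ : 0 ≤ κ)
    (hf : ∀ x, HasDerivAt f (f' x) x) (hf' : ∀ x, HasDerivAt f' (f'' x) x)
    (h : ∀ x ∈ Ioo a b, f x - κ * f'' x ≤ c) (ha : f a ≤ c) (hb : f b ≤ c) :
    ∀ x ∈ Icc a b, f x ≤ c := by
  intro x hx
  obtain ⟨z, hz, hmax⟩ := isCompact_Icc.exists_isMaxOn ⟨x, hx⟩
    (continuous_iff_continuousAt.2 fun x => (hf x).continuousAt).continuousOn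
  refine (hmax hx).trans ?_
  rcases eq_or_ne z a with rfl | hza
  · exact ha
  rcases eq_or_ne z b with rfl | hzb
  · exact hb
  have hzi : z ∈ Ioo a b := ⟨lt_of_le_of_ne hz.1 hza.symm, lt_of_le_of_ne hz.2 hzb⟩
  have := (hmax.isLocalMax (Icc_mem_nhds hzi.1 hzi.2)).second_deriv_nonpos hf hf'
  -- At an interior maximum point `z`, `f z ≤ f z - κ * f'' z ≤ c`.
  nlinarith [h z hzi]

/-! ### The Helmholtz filter on `[0, L]`: explicit solution and bounds independent of `α` -/

/-- The particular solution of `z - α² z'' = y` with vanishing Cauchy data at `0`. -/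
noncomputable def helmholtzPart (α : ℝ) (y : ℝ → ℝ) (x : ℝ) : ℝ :=
  -α⁻¹ * (sinh (α⁻¹ * x) * (∫ s in (0 : ℝ)..x, cosh (α⁻¹ * s) * y s)
    - cosh (α⁻¹ * x) * ∫ s in (0 : ℝ)..x, sinh (α⁻¹ * s) * y s)

/-- The derivative of `helmholtzPart`. -/
noncomputable def helmholtzPartDeriv (α : ℝ) (y : ℝ → ℝ) (x : ℝ) : ℝ :=
  -α⁻¹ ^ 2 * (cosh (α⁻¹ * x) * (∫ s in (0 : ℝ)..x, cosh (α⁻¹ * s) * y s)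
    - sinh (α⁻¹ * x) * ∫ s in (0 : ℝ)..x, sinh (α⁻¹ * s) * y s)

/-- The coefficient of `sinh (x / α)` in `helmholtz`. -/
noncomputable def helmholtzCoeff (α L : ℝ) (y : ℝ → ℝ) : ℝ :=
  (y L - helmholtzPart α y L - y 0 * cosh (α⁻¹ * L)) / sinh (α⁻¹ * L)

/-- The solution of `z - α² z'' = y` on `[0, L]` with `z = y` at both endpoints. -/
noncomputable def helmholtz (α L : ℝ) (y : ℝ → ℝ) (x : ℝ) : ℝ :=
  helmholtzPart α y x + y 0 * cosh (α⁻¹ * x) + helmholtzCoeff α L y * sinh (α⁻¹ * x)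

/-- The derivative of `helmholtz`. -/
noncomputable def helmholtzDeriv (α L : ℝ) (y : ℝ → ℝ) (x : ℝ) : ℝ :=
  helmholtzPartDeriv α y x + α⁻¹ * (y 0 * sinh (α⁻¹ * x) + helmholtzCoeff α L y * cosh (α⁻¹ * x))

section Helmholtz

variable {α L : ℝ} {y : ℝ → ℝ}

theorem hasDerivAt_sinh_mul (k x : ℝ) : HasDerivAt (fun x => sinh (k * x)) (k * cosh (k * x)) x := by
  simpa [mul_comm] using ((hasDerivAt_id x).const_mul k).sinh

theorem hasDerivAt_cosh_mul (k x : ℝ) : HasDerivAt (fun x => cosh (k * x)) (k * sinh (k * x)) x := by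
  simpa [mul_comm] using ((hasDerivAt_id x).const_mul k).cosh

theorem hasDerivAt_mul_left (k x : ℝ) : HasDerivAt (fun x => k * x) k x := by
  simpa using (hasDerivAt_id x).const_mul k

theorem hasDerivAt_weighted_primitive {g : ℝ → ℝ} (hg : Continuous g) (hy : Continuous y) (x : ℝ) :
    HasDerivAt (fun x => ∫ s in (0 : ℝ)..x, g s * y s) (g x * y x) x :=
  ((hg.mul hy).integral_hasStrictDerivAt 0 x).hasDerivAt

theorem hasDerivAt_helmholtzPart (hy : Continuous y) (x : ℝ) :
    HasDerivAt (helmholtzPart α y) (helmholtzPartDeriv α y x) x := by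
  have hc := hasDerivAt_weighted_primitive (g := fun s => cosh (α⁻¹ * s)) (by fun_prop) hy x
  have hs := hasDerivAt_weighted_primitive (g := fun s => sinh (α⁻¹ * s)) (by fun_prop) hy x
  refine ((((hasDerivAt_sinh_mul α⁻¹ x).mul hc).sub
    ((hasDerivAt_cosh_mul α⁻¹ x).mul hs)).const_mul (-α⁻¹)).congr_deriv ?_
  simp only [helmholtzPartDeriv]; ring

theorem hasDerivAt_helmholtzPartDeriv (hy : Continuous y) (x : ℝ) :
    HasDerivAt (helmholtzPartDeriv α y) (α⁻¹ ^ 2 * (helmholtzPart α y x - y x)) x := by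
  have hc := hasDerivAt_weighted_primitive (g := fun s => cosh (α⁻¹ * s)) (by fun_prop) hy x
  have hs := hasDerivAt_weighted_primitive (g := fun s => sinh (α⁻¹ * s)) (by fun_prop) hy x
  refine ((((hasDerivAt_cosh_mul α⁻¹ x).mul hc).sub
    ((hasDerivAt_sinh_mul α⁻¹ x).mul hs)).const_mul (-α⁻¹ ^ 2)).congr_deriv ?_
  simp only [helmholtzPart]
  linear_combination (-α⁻¹ ^ 2 * y x) * Real.cosh_sq (α⁻¹ * x)

theorem hasDerivAt_helmholtz (hy : Continuous y) (x : ℝ) :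
    HasDerivAt (helmholtz α L y) (helmholtzDeriv α L y x) x := by
  refine (((hasDerivAt_helmholtzPart hy x).add ((hasDerivAt_cosh_mul α⁻¹ x).const_mul (y 0))).add
    ((hasDerivAt_sinh_mul α⁻¹ x).const_mul (helmholtzCoeff α L y))).congr_deriv ?_
  simp only [helmholtzDeriv]; ring

theorem hasDerivAt_helmholtzDeriv (hy : Continuous y) (x : ℝ) :
    HasDerivAt (helmholtzDeriv α L y) (α⁻¹ ^ 2 * (helmholtz α L y x - y x)) x := by
  refine ((hasDerivAt_helmholtzPartDeriv hy x).add
    ((((hasDerivAt_sinh_mul α⁻¹ x).const_mul (y 0)).add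
    ((hasDerivAt_cosh_mul α⁻¹ x).const_mul (helmholtzCoeff α L y))).const_mul α⁻¹)).congr_deriv ?_
  simp only [helmholtz]; ring

theorem helmholtz_zero : helmholtz α L y 0 = y 0 := by
  simp [helmholtz, helmholtzPart]

theorem helmholtz_right (hα : 0 < α) (hL : 0 < L) : helmholtz α L y L = y L := by
  have : sinh (α⁻¹ * L) ≠ 0 := (Real.sinh_pos_iff.2 (by positivity)).ne'
  simp only [helmholtz, helmholtzCoeff]
  field_simp
  ring

/-- Linearity of the filter turns sup bounds into bounds on differences of filtered states, as the
contraction estimate requires. -/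
theorem helmholtz_sub {y₁ y₂ : ℝ → ℝ} (h₁ : Continuous y₁) (h₂ : Continuous y₂) (x : ℝ) :
    helmholtz α L (fun x => y₁ x - y₂ x) x = helmholtz α L y₁ x - helmholtz α L y₂ x := by
  have key : ∀ x, helmholtzPart α (fun x => y₁ x - y₂ x) x
      = helmholtzPart α y₁ x - helmholtzPart α y₂ x := by
    intro x
    have e : ∀ g : ℝ → ℝ, Continuous g → (∫ s in (0 : ℝ)..x, g s * (y₁ s - y₂ s)) =
        (∫ s in (0 : ℝ)..x, g s * y₁ s) - ∫ s in (0 : ℝ)..x, g s * y₂ s := by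
      intro g hg
      simp_rw [mul_sub]
      exact intervalIntegral.integral_sub ((hg.mul h₁).intervalIntegrable _ _)
        ((hg.mul h₂).intervalIntegrable _ _)
    simp only [helmholtzPart, e _ (by fun_prop : Continuous fun s => cosh (α⁻¹ * s)),
      e _ (by fun_prop : Continuous fun s => sinh (α⁻¹ * s))]
    ring
  simp only [helmholtz, helmholtzCoeff, key]
  ring

/-- Oddness makes the one-sided comparison estimates two-sided. -/
theorem helmholtz_neg (x : ℝ) :
    helmholtz α L (fun x => -y x) x = -helmholtz α L y x := by
  have key : ∀ x, helmholtzPart α (fun x => -y x) x = -helmholtzPart α y x := by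
    intro x
    simp only [helmholtzPart, mul_neg, intervalIntegral.integral_neg]
    ring
  simp only [helmholtz, helmholtzCoeff, key]
  ring

/-- A one-sided maximum principle for `helmholtz`. -/
theorem helmholtz_le (hα : 0 < α) (hL : 0 < L) (hy : Continuous y) {c : ℝ}
    (h : ∀ x ∈ Icc 0 L, y x ≤ c) : ∀ x ∈ Icc 0 L, helmholtz α L y x ≤ c := by
  refine le_of_sub_mul_second_deriv_le (sq_nonneg α) (hasDerivAt_helmholtz hy)
    (hasDerivAt_helmholtzDeriv hy) (fun x hx => ?_) ?_ ?_
  · have : α ^ 2 * (α⁻¹ ^ 2 * (helmholtz α L y x - y x)) = helmholtz α L y x - y x := by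
      field_simp
    rw [this]
    linarith [h x (Ioo_subset_Icc_self hx)]
  · rw [helmholtz_zero]; exact h 0 (left_mem_Icc.2 hL.le)
  · rw [helmholtz_right hα hL]; exact h L (right_mem_Icc.2 hL.le)

theorem abs_helmholtz_le (hα : 0 < α) (hL : 0 < L) (hy : Continuous y) {c : ℝ}
    (h : ∀ x ∈ Icc 0 L, |y x| ≤ c) : ∀ x ∈ Icc 0 L, |helmholtz α L y x| ≤ c := by
  refine fun x hx => abs_le.2 ⟨?_, helmholtz_le hα hL hy (fun x hx => (abs_le.1 (h x hx)).2) x hx⟩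
  have := helmholtz_le hα hL hy.neg (c := c)
    (fun x hx => by simp only [Pi.neg_apply]; linarith [(abs_le.1 (h x hx)).1]) x hx
  have e := helmholtz_neg (α := α) (L := L) (y := y) x
  change helmholtz α L (fun x => -y x) x ≤ c at this
  linarith

/-- Barrier estimate at the left endpoint. -/
theorem helmholtz_le_left (hα : 0 < α) (hL : 0 < L) (hy : Continuous y) {M : ℝ}
    (h : ∀ x ∈ Icc 0 L, y x ≤ y 0 + M * x) :
    ∀ x ∈ Icc 0 L, helmholtz α L y x ≤ y 0 + M * x := by
  intro x hx
  -- Subtracting the linear barrier does not change the second derivative, so the operator applied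
  -- to the difference gives `y x - M * x`, which is at most `y 0`.
  have := le_of_sub_mul_second_deriv_le (a := 0) (b := L) (c := y 0) (sq_nonneg α)
    (f := fun x => helmholtz α L y x - M * x) (f' := fun x => helmholtzDeriv α L y x - M)
    (f'' := fun x => α⁻¹ ^ 2 * (helmholtz α L y x - y x))
    (fun x => (hasDerivAt_helmholtz hy x).sub (hasDerivAt_mul_left M x))
    (fun x => (hasDerivAt_helmholtzDeriv hy x).sub_const M) (fun x hx => ?_) ?_ ?_ x hx
  · linarith
  · have e : α ^ 2 * (α⁻¹ ^ 2 * (helmholtz α L y x - y x)) = helmholtz α L y x - y x := by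
      field_simp
    rw [e]
    linarith [h x (Ioo_subset_Icc_self hx)]
  · simp [helmholtz_zero]
  · rw [helmholtz_right hα hL]; linarith [h L (right_mem_Icc.2 hL.le)]

/-- Barrier estimate at the right endpoint. -/
theorem le_helmholtz_right (hα : 0 < α) (hL : 0 < L) (hy : Continuous y) {M : ℝ}
    (h : ∀ x ∈ Icc 0 L, y L - M * (L - x) ≤ y x) :
    ∀ x ∈ Icc 0 L, y L - M * (L - x) ≤ helmholtz α L y x := by
  intro x hx
  have := le_of_sub_mul_second_deriv_le (a := 0) (b := L) (c := M * L - y L) (sq_nonneg α)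
    (f := fun x => M * x - helmholtz α L y x) (f' := fun x => M - helmholtzDeriv α L y x)
    (f'' := fun x => -(α⁻¹ ^ 2 * (helmholtz α L y x - y x)))
    (fun x => (hasDerivAt_mul_left M x).sub (hasDerivAt_helmholtz hy x))
    (fun x => (hasDerivAt_helmholtzDeriv hy x).const_sub M) (fun x hx => ?_) ?_ ?_ x hx
  · linarith
  · have e : α ^ 2 * -(α⁻¹ ^ 2 * (helmholtz α L y x - y x)) = -(helmholtz α L y x - y x) := by
      field_simp
    rw [e]
    linarith [h x (Ioo_subset_Icc_self hx)]
  · rw [helmholtz_zero]; linarith [h 0 (left_mem_Icc.2 hL.le)]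
  · rw [helmholtz_right hα hL]

/-- One-sided Lipschitz bounds pass from `y` to `helmholtz α L y`. -/
theorem helmholtz_sub_le (hα : 0 < α) (hL : 0 < L) (hy : Continuous y) {M : ℝ}
    (h : ∀ x ∈ Icc 0 L, ∀ x' ∈ Icc 0 L, x ≤ x' → y x' - y x ≤ M * (x' - x)) :
    ∀ x ∈ Icc 0 L, ∀ x' ∈ Icc 0 L, x ≤ x' →
      helmholtz α L y x' - helmholtz α L y x ≤ M * (x' - x) := by
  intro x hx x' hx' hxx
  obtain ⟨d, rfl⟩ : ∃ d, x' = x + d := ⟨x' - x, by ring⟩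
  have hd : 0 ≤ d := by linarith
  have h0 : (0 : ℝ) ∈ Icc 0 L := left_mem_Icc.2 hL.le
  have hl : L ∈ Icc 0 L := right_mem_Icc.2 hL.le
  have hdL : d ≤ L := by linarith [hx.1, hx'.2]
  have sh : ∀ {f : ℝ → ℝ} {f' : ℝ} (x : ℝ), HasDerivAt f f' (x + d) →
      HasDerivAt (fun x => f (x + d)) f' x := fun x hf => hf.comp_add_const x d
  -- The increment `z (x + d) - z x` solves the same equation on `[0, L - d]` with the increment of
  -- `y` as source. Its boundary values are controlled by the two barrier estimates, because one of
  -- the two points is then an endpoint of `[0, L]`.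
  have := le_of_sub_mul_second_deriv_le (a := 0) (b := L - d) (c := M * d) (sq_nonneg α)
    (f := fun x => helmholtz α L y (x + d) - helmholtz α L y x)
    (f' := fun x => helmholtzDeriv α L y (x + d) - helmholtzDeriv α L y x)
    (f'' := fun x => α⁻¹ ^ 2 * (helmholtz α L y (x + d) - y (x + d))
      - α⁻¹ ^ 2 * (helmholtz α L y x - y x))
    (fun x => (sh x (hasDerivAt_helmholtz hy _)).sub (hasDerivAt_helmholtz hy x))
    (fun x => (sh x (hasDerivAt_helmholtzDeriv hy _)).sub (hasDerivAt_helmholtzDeriv hy x))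
    (fun x hx => ?_) ?_ ?_ x ⟨hx.1, by linarith [hx'.2]⟩
  · linarith
  · have e : α ^ 2 * (α⁻¹ ^ 2 * (helmholtz α L y (x + d) - y (x + d))
        - α⁻¹ ^ 2 * (helmholtz α L y x - y x))
        = (helmholtz α L y (x + d) - y (x + d)) - (helmholtz α L y x - y x) := by
      field_simp
    rw [e]
    linarith [h x ⟨hx.1.le, by linarith [hx.2]⟩ (x + d) ⟨by linarith [hx.1], by linarith [hx.2]⟩
      (by linarith)]
  · have := helmholtz_le_left hα hL hy (M := M) (fun x hx => by linarith [h 0 h0 x hx hx.1])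
      d ⟨hd, hdL⟩
    rw [helmholtz_zero, zero_add]; linarith
  · have := le_helmholtz_right hα hL hy (M := M) (fun x hx => by linarith [h x hx L hl hx.2])
      (L - d) ⟨by linarith, by linarith⟩
    rw [sub_add_cancel, helmholtz_right hα hL]; linarith

theorem abs_helmholtz_sub_le (hα : 0 < α) (hL : 0 < L) (hy : Continuous y) {M : ℝ}
    (h : ∀ x x', |y x - y x'| ≤ M * |x - x'|) :
    ∀ x ∈ Icc 0 L, ∀ x' ∈ Icc 0 L, |helmholtz α L y x - helmholtz α L y x'| ≤ M * |x - x'| := by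
  have key : ∀ x ∈ Icc 0 L, ∀ x' ∈ Icc 0 L, x ≤ x' →
      |helmholtz α L y x - helmholtz α L y x'| ≤ M * |x - x'| := by
    intro x hx x' hx' hxx
    have e : |x - x'| = x' - x := by rw [abs_sub_comm, abs_of_nonneg (by linarith)]
    have h1 := helmholtz_sub_le hα hL hy (M := M) (fun a _ b _ hab => by
      have := (abs_le.1 (h b a)).2; rwa [abs_of_nonneg (by linarith : 0 ≤ b - a)] at this) x hx x' hx' hxx
    have h2 := helmholtz_sub_le hα hL hy.neg (M := M) (fun a _ b _ hab => by
      have := (abs_le.1 (h b a)).1; rw [abs_of_nonneg (by linarith : 0 ≤ b - a)] at this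
      simp only [Pi.neg_apply]; linarith) x hx x' hx' hxx
    have e1 := helmholtz_neg (α := α) (L := L) (y := y) x
    have e2 := helmholtz_neg (α := α) (L := L) (y := y) x'
    change helmholtz α L (fun x => -y x) x' - helmholtz α L (fun x => -y x) x ≤ _ at h2
    rw [e, abs_le]
    constructor <;> linarith
  intro x hx x' hx'
  rcases le_total x x' with hxx | hxx
  · exact key x hx x' hx' hxx
  · rw [abs_sub_comm, abs_sub_comm x]; exact key x' hx' x hx hxx

theorem abs_helmholtzDeriv_le (hα : 0 < α) (hL : 0 < L) (hy : Continuous y) {M : ℝ}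
    (h : ∀ x x', |y x - y x'| ≤ M * |x - x'|) :
    ∀ x ∈ Icc 0 L, |helmholtzDeriv α L y x| ≤ M := by
  have hM : 0 ≤ M := by simpa using (abs_nonneg _).trans (h 1 0)
  have hc : Continuous (helmholtzDeriv α L y) :=
    continuous_iff_continuousAt.2 fun x => (hasDerivAt_helmholtzDeriv hy x).continuousAt
  have key : Ioo 0 L ⊆ {x | |helmholtzDeriv α L y x| ≤ M} := by
    intro x hx
    have := (hasDerivAt_helmholtz (α := α) (L := L) hy x).le_of_lip' hM (by
      filter_upwards [Icc_mem_nhds hx.1 hx.2] with z hz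
      exact abs_helmholtz_sub_le hα hL hy h z hz x (Ioo_subset_Icc_self hx))
    simpa using this
  -- The bound reaches the endpoints by continuity of the derivative.
  have := closure_minimal key (isClosed_le hc.abs continuous_const)
  rwa [closure_Ioo hL.ne] at this

end Helmholtz

/-! ### Joint regularity of the filtered state in time and space -/

section HelmholtzParam

variable {α L : ℝ} {y : ℝ → ℝ → ℝ}

theorem continuous_weighted_primitive {g : ℝ → ℝ} (hg : Continuous g)
    (hy : Continuous fun p : ℝ × ℝ => y p.1 p.2) :
    Continuous fun p : ℝ × ℝ => ∫ s in (0 : ℝ)..p.2, g s * y p.1 s :=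
  intervalIntegral.continuous_parametric_intervalIntegral_of_continuous
    (f := fun (p : ℝ × ℝ) s => g s * y p.1 s)
    ((hg.comp continuous_snd).mul
      (hy.comp (by fun_prop : Continuous fun q : (ℝ × ℝ) × ℝ => (q.1.1, q.2)))) continuous_snd

theorem continuous_helmholtz (hy : Continuous fun p : ℝ × ℝ => y p.1 p.2) :
    (Continuous fun p : ℝ × ℝ => helmholtz α L (y p.1) p.2) ∧
      Continuous fun p : ℝ × ℝ => helmholtzDeriv α L (y p.1) p.2 := by
  have hc := continuous_weighted_primitive (g := fun s => cosh (α⁻¹ * s)) (by fun_prop) hy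
  have hs := continuous_weighted_primitive (g := fun s => sinh (α⁻¹ * s)) (by fun_prop) hy
  have hP : Continuous fun p : ℝ × ℝ => helmholtzPart α (y p.1) p.2 := by
    unfold helmholtzPart; fun_prop
  have hy0 : ∀ a, Continuous fun p : ℝ × ℝ => y p.1 a :=
    fun a => hy.comp (by fun_prop : Continuous fun p : ℝ × ℝ => (p.1, a))
  have hPL : Continuous fun p : ℝ × ℝ => helmholtzPart α (y p.1) L :=
    hP.comp (by fun_prop : Continuous fun p : ℝ × ℝ => (p.1, L))
  have hB : Continuous fun p : ℝ × ℝ => helmholtzCoeff α L (y p.1) := by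
    unfold helmholtzCoeff
    exact ((((hy0 L).sub hPL).sub ((hy0 0).mul continuous_const))).div_const _
  constructor
  · unfold helmholtz
    exact (hP.add ((hy0 0).mul (by fun_prop))).add (hB.mul (by fun_prop))
  · unfold helmholtzDeriv helmholtzPartDeriv
    have := hy0 0
    fun_prop

theorem contDiff_helmholtz (hy : ContDiff ℝ 1 fun p : ℝ × ℝ => y p.1 p.2) :
    ContDiff ℝ 1 fun p : ℝ × ℝ => helmholtz α L (y p.1) p.2 := by
  have hc := contDiff_one_weighted_primitive (g := fun s => cosh (α⁻¹ * s)) (by fun_prop) hy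
  have hs := contDiff_one_weighted_primitive (g := fun s => sinh (α⁻¹ * s)) (by fun_prop) hy
  have hS : ContDiff ℝ 1 fun p : ℝ × ℝ => sinh (α⁻¹ * p.2) :=
    Real.contDiff_sinh.comp (contDiff_const.mul contDiff_snd)
  have hC : ContDiff ℝ 1 fun p : ℝ × ℝ => cosh (α⁻¹ * p.2) :=
    Real.contDiff_cosh.comp (contDiff_const.mul contDiff_snd)
  have hP : ContDiff ℝ 1 fun p : ℝ × ℝ => helmholtzPart α (y p.1) p.2 := by
    unfold helmholtzPart
    exact contDiff_const.mul ((hS.mul hc).sub (hC.mul hs))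
  have hy0 : ∀ a, ContDiff ℝ 1 fun p : ℝ × ℝ => y p.1 a :=
    fun a => hy.comp (contDiff_fst.prodMk contDiff_const : ContDiff ℝ 1 fun p : ℝ × ℝ => (p.1, a))
  have hPL : ContDiff ℝ 1 fun p : ℝ × ℝ => helmholtzPart α (y p.1) L :=
    hP.comp (contDiff_fst.prodMk contDiff_const : ContDiff ℝ 1 fun p : ℝ × ℝ => (p.1, L))
  have hB : ContDiff ℝ 1 fun p : ℝ × ℝ => helmholtzCoeff α L (y p.1) := by
    unfold helmholtzCoeff
    exact (((hy0 L).sub hPL).sub ((hy0 0).mul contDiff_const)).div_const _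
  exact (hP.add ((hy0 0).mul hC)).add (hB.mul hS)

end HelmholtzParam

/-! ### A `C^1` extension from `[0, L]` to the line by folding -/

/-- The projection of `x` onto `[0, L]`, written as `x + x⁻ - (x - L)⁺`. -/
noncomputable def clampPoint (L x : ℝ) : ℝ := x + max (-x) 0 - max (x - L) 0

/-- A map `ℝ → [0, L]` that is the identity on `[0, L]` and folds the outside back into `[0, L]`. -/
noncomputable def foldPoint (L x : ℝ) : ℝ :=
  clampPoint L x + L * (1 - Real.exp (-max (-x) 0 / L)) - L * (1 - Real.exp (-max (x - L) 0 / L))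

/-- The absolute value of the slope of `foldPoint`. -/
noncomputable def foldSlope (L x : ℝ) : ℝ :=
  Real.exp (-max (-x) 0 / L) * Real.exp (-max (x - L) 0 / L)

/-- The extension of `f` from `[0, L]` to `ℝ` by odd reflection at the endpoints. -/
noncomputable def foldExt (L : ℝ) (f : ℝ → ℝ) (x : ℝ) : ℝ := 2 * f (clampPoint L x) - f (foldPoint L x)

section Fold

variable {L x : ℝ}

theorem clampPoint_of_mem (hx : x ∈ Icc 0 L) : clampPoint L x = x := by
  rw [clampPoint, max_eq_right (by linarith [hx.1]), max_eq_right (by linarith [hx.2])]; ring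

theorem foldPoint_of_mem (hx : x ∈ Icc 0 L) : foldPoint L x = x := by
  rw [foldPoint, clampPoint_of_mem hx, max_eq_right (by linarith [hx.1]),
    max_eq_right (by linarith [hx.2])]
  simp

theorem foldSlope_of_mem (hx : x ∈ Icc 0 L) : foldSlope L x = 1 := by
  rw [foldSlope, max_eq_right (by linarith [hx.1]), max_eq_right (by linarith [hx.2])]
  simp

theorem clampPoint_of_nonpos (hL : 0 < L) (hx : x ≤ 0) : clampPoint L x = 0 := by
  rw [clampPoint, max_eq_left (by linarith), max_eq_right (by linarith)]; ring

theorem foldPoint_of_nonpos (hL : 0 < L) (hx : x ≤ 0) :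
    foldPoint L x = L * (1 - Real.exp (x / L)) := by
  rw [foldPoint, clampPoint_of_nonpos hL hx, max_eq_left (by linarith), max_eq_right (by linarith)]
  simp

theorem foldSlope_of_nonpos (hL : 0 < L) (hx : x ≤ 0) : foldSlope L x = Real.exp (x / L) := by
  rw [foldSlope, max_eq_left (by linarith), max_eq_right (by linarith)]
  simp

theorem clampPoint_of_ge (hL : 0 < L) (hx : L ≤ x) : clampPoint L x = L := by
  rw [clampPoint, max_eq_right (by linarith), max_eq_left (by linarith)]; ring

theorem foldPoint_of_ge (hL : 0 < L) (hx : L ≤ x) :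
    foldPoint L x = L * Real.exp ((L - x) / L) := by
  rw [foldPoint, clampPoint_of_ge hL hx, max_eq_right (by linarith), max_eq_left (by linarith)]
  simp; ring

theorem foldSlope_of_ge (hL : 0 < L) (hx : L ≤ x) : foldSlope L x = Real.exp ((L - x) / L) := by
  rw [foldSlope, max_eq_right (by linarith), max_eq_left (by linarith)]
  simp

theorem continuous_clampPoint : Continuous (clampPoint L) := by unfold clampPoint; fun_prop

theorem continuous_foldPoint : Continuous (foldPoint L) := by
  unfold foldPoint clampPoint; fun_prop

theorem continuous_foldSlope : Continuous (foldSlope L) := by unfold foldSlope; fun_prop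

theorem clampPoint_mem (hL : 0 < L) (x : ℝ) : clampPoint L x ∈ Icc 0 L := by
  rcases le_total x 0 with h | h
  · rw [clampPoint_of_nonpos hL h]; exact left_mem_Icc.2 hL.le
  rcases le_total x L with h' | h'
  · rw [clampPoint_of_mem ⟨h, h'⟩]; exact ⟨h, h'⟩
  · rw [clampPoint_of_ge hL h']; exact right_mem_Icc.2 hL.le

theorem foldPoint_mem (hL : 0 < L) (x : ℝ) : foldPoint L x ∈ Icc 0 L := by
  rcases le_total x 0 with h | h
  · rw [foldPoint_of_nonpos hL h]
    have := Real.exp_le_one_iff.2 (div_nonpos_of_nonpos_of_nonneg h hL.le)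
    have := Real.exp_pos (x / L)
    constructor <;> nlinarith
  rcases le_total x L with h' | h'
  · rw [foldPoint_of_mem ⟨h, h'⟩]; exact ⟨h, h'⟩
  · rw [foldPoint_of_ge hL h']
    have := Real.exp_le_one_iff.2 (div_nonpos_of_nonpos_of_nonneg (by linarith : L - x ≤ 0) hL.le)
    have := Real.exp_pos ((L - x) / L)
    constructor <;> nlinarith

theorem foldSlope_mem (L x : ℝ) (hL : 0 < L) : foldSlope L x ∈ Icc 0 1 := by
  have : ∀ a : ℝ, 0 ≤ a → Real.exp (-a / L) ≤ 1 := fun a ha =>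
    Real.exp_le_one_iff.2 (div_nonpos_of_nonpos_of_nonneg (by linarith) hL.le)
  exact ⟨by unfold foldSlope; positivity, mul_le_one₀ (this _ (le_max_right _ _)) (Real.exp_pos _).le
    (this _ (le_max_right _ _))⟩

theorem foldExt_of_mem {f : ℝ → ℝ} (hx : x ∈ Icc 0 L) : foldExt L f x = f x := by
  rw [foldExt, clampPoint_of_mem hx, foldPoint_of_mem hx]; ring

theorem abs_foldExt_le (hL : 0 < L) {f : ℝ → ℝ} {c : ℝ} (h : ∀ x ∈ Icc 0 L, |f x| ≤ c) (x : ℝ) :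
    |foldExt L f x| ≤ 3 * c := by
  have h1 := abs_le.1 (h _ (clampPoint_mem hL x))
  have h2 := abs_le.1 (h _ (foldPoint_mem hL x))
  rw [foldExt, abs_le]
  constructor <;> linarith [h1.1, h1.2, h2.1, h2.2]

/-- To the left of `0` the extension is `2 f(0) - f(φ)` with `φ' = -exp (x / L)`; the two minus
signs cancel and the slope factor is `1` at `0`, so the one-sided derivatives match. The right end
is symmetric. The derivative is computed within three closed sets covering `ℝ`; away from a set's
closure the statement is vacuous. -/
theorem hasDerivAt_foldExt (hL : 0 < L) {f f' : ℝ → ℝ} (hf : ∀ x, HasDerivAt f (f' x) x) (x : ℝ) :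
    HasDerivAt (foldExt L f) (f' (foldPoint L x) * foldSlope L x) x := by
  have h1 : HasDerivWithinAt (foldExt L f) (f' (foldPoint L x) * foldSlope L x) (Iic 0) x := by
    by_cases hx : x ∈ Iic 0
    · have e : HasDerivAt (fun x => L * (1 - Real.exp (x / L))) (-Real.exp (x / L)) x := by
        refine ((((hasDerivAt_id x).div_const L).exp.const_sub 1).const_mul L).congr_deriv ?_
        simp; field_simp
      rw [foldPoint_of_nonpos hL hx, foldSlope_of_nonpos hL hx]
      have := (((hf (L * (1 - Real.exp (x / L)))).comp x e).const_sub (2 * f 0)).hasDerivWithinAt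
        (s := Iic 0)
      refine (this.congr_deriv (by ring)).congr (fun z hz => ?_) ?_
      · rw [foldExt, clampPoint_of_nonpos hL hz, foldPoint_of_nonpos hL hz]; rfl
      · rw [foldExt, clampPoint_of_nonpos hL hx, foldPoint_of_nonpos hL hx]; rfl
    · exact hasDerivWithinAt_iff_hasFDerivWithinAt.2 (.of_notMem_closure (by rwa [closure_Iic]))
  have h2 : HasDerivWithinAt (foldExt L f) (f' (foldPoint L x) * foldSlope L x) (Icc 0 L) x := by
    by_cases hx : x ∈ Icc 0 L
    · rw [foldPoint_of_mem hx, foldSlope_of_mem hx, mul_one]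
      exact (hf x).hasDerivWithinAt.congr (fun z hz => foldExt_of_mem hz) (foldExt_of_mem hx)
    · exact hasDerivWithinAt_iff_hasFDerivWithinAt.2 (.of_notMem_closure (by rwa [closure_Icc]))
  have h3 : HasDerivWithinAt (foldExt L f) (f' (foldPoint L x) * foldSlope L x) (Ici L) x := by
    by_cases hx : x ∈ Ici L
    · have e : HasDerivAt (fun x => L * Real.exp ((L - x) / L)) (-Real.exp ((L - x) / L)) x := by
        refine ((((hasDerivAt_id x).const_sub L).div_const L).exp.const_mul L).congr_deriv ?_
        simp; field_simp
      rw [foldPoint_of_ge hL hx, foldSlope_of_ge hL hx]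
      have := (((hf (L * Real.exp ((L - x) / L))).comp x e).const_sub (2 * f L)).hasDerivWithinAt
        (s := Ici L)
      refine (this.congr_deriv (by ring)).congr (fun z hz => ?_) ?_
      · rw [foldExt, clampPoint_of_ge hL hz, foldPoint_of_ge hL hz]; rfl
      · rw [foldExt, clampPoint_of_ge hL hx, foldPoint_of_ge hL hx]; rfl
    · exact hasDerivWithinAt_iff_hasFDerivWithinAt.2 (.of_notMem_closure (by rwa [closure_Ici]))
  have hu : (Iic 0 ∪ Icc 0 L) ∪ Ici L = univ := by
    rw [Iic_union_Icc_eq_Iic hL.le, Iic_union_Ici]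
  rw [← hasDerivWithinAt_univ, ← hu]
  exact (h1.union h2).union h3

end Fold

/-! ### Characteristics, and regularity and stability of the backward flow -/

/-- `V` is a bounded continuous velocity field on `ℝ`, of class `C^1` in space with bounded
continuous space derivative `W`. -/
structure IsVelocity (V W : ℝ → ℝ → ℝ) (N M : ℝ) : Prop where
  cont : Continuous fun p : ℝ × ℝ => V p.1 p.2
  cont_deriv : Continuous fun p : ℝ × ℝ => W p.1 p.2
  hasDerivAt : ∀ t x, HasDerivAt (V t) (W t x) x
  abs_le : ∀ t x, |V t x| ≤ N
  abs_deriv_le : ∀ t x, |W t x| ≤ M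

/-- The average of `W t` over the segment from `b` to `a`. -/
noncomputable def avgSlope (W : ℝ → ℝ → ℝ) (t a b : ℝ) : ℝ := ∫ θ in (0 : ℝ)..1, W t (b + θ * (a - b))

/-- `γ` is the characteristic of `V` through `x` at time `t`. -/
def IsCharacteristic (V : ℝ → ℝ → ℝ) (t x : ℝ) (γ : ℝ → ℝ) : Prop :=
  γ t = x ∧ ∀ s, HasDerivAt γ (V s (γ s)) s

/-- The characteristic of `V` through `x` at time `t`. -/
noncomputable def characteristic (V : ℝ → ℝ → ℝ) (t x : ℝ) : ℝ → ℝ :=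
  Classical.epsilon (IsCharacteristic V t x)

/-- The position at time `0` of the characteristic through `x` at time `t`. -/
noncomputable def backFlow (V : ℝ → ℝ → ℝ) (t x : ℝ) : ℝ := characteristic V t x 0

/-- Linear scalar equations are solved by an exponential. -/
theorem eq_mul_exp_of_hasDerivAt {D m : ℝ → ℝ} (hm : Continuous m)
    (hD : ∀ s, HasDerivAt D (m s * D s) s) (t s : ℝ) :
    D s = D t * Real.exp (∫ r in t..s, m r) := by
  have hI : ∀ s, HasDerivAt (fun s => ∫ r in t..s, m r) (m s) s := fun s =>
    (hm.integral_hasStrictDerivAt t s).hasDerivAt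
  have h : ∀ s, HasDerivAt (fun s => D s * Real.exp (-∫ r in t..s, m r)) 0 s := fun s =>
    ((hD s).mul (hI s).neg.exp).congr_deriv (by ring)
  have := is_const_of_deriv_eq_zero (fun s => (h s).differentiableAt) (fun s => (h s).deriv) s t
  simp only [intervalIntegral.integral_same, neg_zero, Real.exp_zero, mul_one, Real.exp_neg] at this
  rw [← this]
  field_simp

/-- Stability estimate for linear scalar equations with a source. -/
theorem abs_le_of_hasDerivAt_linear {D m r : ℝ → ℝ} {t T M ε : ℝ} (hm : Continuous m)
    (hM : ∀ s, |m s| ≤ M) (hr : ∀ s, |r s| ≤ ε) (hD : ∀ s, HasDerivAt D (m s * D s + r s) s)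
    (ht : t ∈ Icc 0 T) (h0 : D t = 0) : |D 0| ≤ ε * Real.exp (M * T) * T := by
  have hM0 : 0 ≤ M := (abs_nonneg _).trans (hM 0)
  have hε : 0 ≤ ε := (abs_nonneg _).trans (hr 0)
  have hI : ∀ s, HasDerivAt (fun s => ∫ r in (0 : ℝ)..s, m r) (m s) s := fun s =>
    (hm.integral_hasStrictDerivAt 0 s).hasDerivAt
  have h : ∀ s, HasDerivAt (fun s => D s * Real.exp (-∫ r in (0 : ℝ)..s, m r))
      (r s * Real.exp (-∫ r in (0 : ℝ)..s, m r)) s := fun s =>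
    ((hD s).mul (hI s).neg.exp).congr_deriv (by simp only [Pi.neg_apply]; ring)
  -- After multiplication by the integrating factor only the source is left in the derivative. The
  -- weighted function vanishes at `t`, and its weight is `1` at `0`.
  have := norm_image_sub_le_of_norm_deriv_le_segment' (a := 0) (b := t) (C := ε * Real.exp (M * T))
    (fun s _ => (h s).hasDerivWithinAt) (fun s hs => ?_) t (right_mem_Icc.2 ht.1)
  · rw [h0] at this
    simp only [zero_mul, intervalIntegral.integral_same, neg_zero, Real.exp_zero, mul_one, zero_sub,
      norm_neg, sub_zero, Real.norm_eq_abs] at this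
    exact this.trans (mul_le_mul_of_nonneg_left ht.2 (by positivity))
  · rw [norm_mul, Real.norm_eq_abs, Real.norm_eq_abs, Real.abs_exp]
    refine mul_le_mul (hr s) (Real.exp_le_exp.2 ?_) (Real.exp_pos _).le hε
    have := intervalIntegral.norm_integral_le_of_norm_le_const (f := m) (a := 0) (b := s) (C := M)
      (fun x _ => hM x)
    rw [sub_zero, abs_of_nonneg hs.1, Real.norm_eq_abs] at this
    have := (abs_le.1 this).1
    nlinarith [hs.2, ht.2]

/-- The product of a differentiable function vanishing at a point and of a function continuous
there is differentiable at that point. -/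
theorem HasFDerivAt.mul_of_eq_zero {E : Type*} [NormedAddCommGroup E] [NormedSpace ℝ E]
    {g h : E → ℝ} {g' : E →L[ℝ] ℝ} {p : E} (hg : HasFDerivAt g g' p) (hg0 : g p = 0)
    (hh : ContinuousAt h p) : HasFDerivAt (fun q => g q * h q) (h p • g') p := by
  rw [hasFDerivAt_iff_isLittleO] at hg ⊢
  -- The remainder splits into the remainder of `g` times the locally bounded `h`, and `g' (q - p)`
  -- times the increment of `h`, which tends to `0`.
  have h1 : (fun q => (g q - g p - g' (q - p)) * h q) =o[𝓝 p] fun q => (q - p) := by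
    simpa using (hg.norm_right.mul_isBigO (hh.isBigO_one ℝ))
  have h2 : (fun q => g' (q - p) * (h q - h p)) =o[𝓝 p] fun q => (q - p) := by
    have := (g'.isBigO_sub (𝓝 p) p).norm_right.mul_isLittleO
      ((Asymptotics.isLittleO_one_iff ℝ).2 (by simpa using hh.tendsto.sub_const (h p) :
        Tendsto (fun q => h q - h p) (𝓝 p) (𝓝 0)))
    simpa using this
  refine (h1.add h2).congr_left fun q => ?_
  simp [hg0]; ring

theorem continuous_avgSlope {W : ℝ → ℝ → ℝ} (hW : Continuous fun p : ℝ × ℝ => W p.1 p.2) :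
    Continuous fun p : ℝ × ℝ × ℝ => avgSlope W p.1 p.2.1 p.2.2 := by
  refine intervalIntegral.continuous_parametric_intervalIntegral_of_continuous'
    (f := fun (p : ℝ × ℝ × ℝ) θ => W p.1 (p.2.2 + θ * (p.2.1 - p.2.2))) ?_ 0 1
  exact hW.comp (by fun_prop : Continuous fun q : (ℝ × ℝ × ℝ) × ℝ =>
    (q.1.1, q.1.2.2 + q.2 * (q.1.2.1 - q.1.2.2)))

theorem avgSlope_self (W : ℝ → ℝ → ℝ) (t a : ℝ) : avgSlope W t a a = W t a := by
  simp [avgSlope]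

namespace IsVelocity

variable {V W : ℝ → ℝ → ℝ} {N M : ℝ}

/-- This integral mean value formula makes the difference of two characteristics solve a linear
scalar equation with continuous coefficient. -/
theorem sub_eq_avgSlope_mul (h : IsVelocity V W N M) (t a b : ℝ) :
    V t a - V t b = avgSlope W t a b * (a - b) := by
  have hd : ∀ θ : ℝ, HasDerivAt (fun θ => V t (b + θ * (a - b))) (W t (b + θ * (a - b)) * (a - b)) θ :=
    fun θ => (h.hasDerivAt t (b + θ * (a - b))).comp θ
      (by simpa using ((hasDerivAt_id θ).mul_const (a - b)).const_add b)
  have hc : Continuous fun θ : ℝ => W t (b + θ * (a - b)) :=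
    h.cont_deriv.comp (by fun_prop : Continuous fun θ : ℝ => (t, b + θ * (a - b)))
  have := intervalIntegral.integral_eq_sub_of_hasDerivAt (a := 0) (b := 1) (fun θ _ => hd θ)
    ((hc.mul continuous_const).intervalIntegrable _ _)
  rw [intervalIntegral.integral_mul_const] at this
  simp only [one_mul, zero_mul, add_zero, add_sub_cancel] at this
  exact this.symm

theorem abs_avgSlope_le (h : IsVelocity V W N M) (t a b : ℝ) : |avgSlope W t a b| ≤ M := by
  simpa [avgSlope] using intervalIntegral.norm_integral_le_of_norm_le_const (a := 0) (b := 1)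
    (f := fun θ => W t (b + θ * (a - b))) (C := M) (fun θ _ => h.abs_deriv_le _ _)

theorem bound_nonneg (h : IsVelocity V W N M) : 0 ≤ N := (abs_nonneg _).trans (h.abs_le 0 0)

theorem deriv_bound_nonneg (h : IsVelocity V W N M) : 0 ≤ M :=
  (abs_nonneg _).trans (h.abs_deriv_le 0 0)

theorem lipschitzWith (h : IsVelocity V W N M) (t : ℝ) : LipschitzWith M.toNNReal (V t) := by
  refine LipschitzWith.of_dist_le_mul fun a b => ?_
  rw [Real.coe_toNNReal _ h.deriv_bound_nonneg, Real.dist_eq, Real.dist_eq,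
    h.sub_eq_avgSlope_mul, abs_mul]
  exact mul_le_mul_of_nonneg_right (h.abs_avgSlope_le _ _ _) (abs_nonneg _)

theorem exists_local_characteristic (h : IsVelocity V W N M) (t x : ℝ) (n : ℕ) :
    ∃ γ : ℝ → ℝ, γ t = x ∧ ∀ s ∈ Ioo (t - (n + 1)) (t + (n + 1)), HasDerivAt γ (V s (γ s)) s := by
  have hn : (0 : ℝ) < n + 1 := by positivity
  -- At speed at most `N`, a solution stays within `N * (n + 1)` of `x` during time `n + 1`, so
  -- boundedness of `V` permits an arbitrarily long interval.
  have hP : IsPicardLindelof V (tmin := t - (n + 1)) (tmax := t + (n + 1))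
      ⟨t, by linarith, by linarith⟩ x (N.toNNReal * (n + 1)) 0 N.toNNReal M.toNNReal := by
    refine ⟨fun s _ => (h.lipschitzWith s).lipschitzOnWith, fun z _ => ?_, fun s _ z _ => ?_, ?_⟩
    · exact (h.cont.comp (by fun_prop : Continuous fun s : ℝ => (s, z))).continuousOn
    · rw [Real.coe_toNNReal _ h.bound_nonneg]; exact h.abs_le s z
    · simp
  obtain ⟨γ, h0, hγ⟩ := hP.exists_eq_forall_mem_Icc_hasDerivWithinAt₀
  exact ⟨γ, h0, fun s hs => (hγ s (Ioo_subset_Icc_self hs)).hasDerivAt (Icc_mem_nhds hs.1 hs.2)⟩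

theorem exists_characteristic (h : IsVelocity V W N M) (t x : ℝ) :
    ∃ γ, IsCharacteristic V t x γ := by
  choose γ h0 hγ using h.exists_local_characteristic t x
  have agree : ∀ k m : ℕ, k ≤ m → EqOn (γ k) (γ m) (Ioo (t - (k + 1)) (t + (k + 1))) := by
    intro k m hkm
    have hk : (k : ℝ) ≤ m := by exact_mod_cast hkm
    have hk0 : (0 : ℝ) ≤ k := by positivity
    exact ODE_solution_unique_of_mem_Ioo (v := V) (s := fun _ => univ) (t₀ := t)
      (fun s _ => (h.lipschitzWith s).lipschitzOnWith) ⟨by linarith, by linarith⟩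
      (fun s hs => ⟨hγ k s hs, trivial⟩)
      (fun s hs => ⟨hγ m s ⟨by linarith [hs.1], by linarith [hs.2]⟩, trivial⟩) (by rw [h0, h0])
  -- The local solutions are glued by index `⌈|s - t|⌉₊`. The half-width `k + 1`, rather than `k`,
  -- keeps `s` inside the open interval even when `|s - t|` is an integer.
  have loc : ∀ (m : ℕ) (s : ℝ), |s - t| < m → γ ⌈|s - t|⌉₊ s = γ m s := by
    intro m s hs
    refine agree _ m (Nat.ceil_le.2 hs.le) ?_
    have := _root_.abs_le.1 (Nat.le_ceil |s - t|)
    constructor <;> linarith [this.1, this.2]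
  refine ⟨fun s => γ ⌈|s - t|⌉₊ s, by simp [h0], fun s => ?_⟩
  obtain ⟨m, hm⟩ := exists_nat_gt |s - t|
  have hs := _root_.abs_lt.1 hm
  have hd := hγ m s ⟨by linarith [hs.1], by linarith [hs.2]⟩
  rw [← loc m s hm] at hd
  refine hd.congr_of_eventuallyEq ?_
  have : ∀ᶠ r in 𝓝 s, |r - t| < m :=
    (by fun_prop : Continuous fun r : ℝ => |r - t|).continuousAt.eventually_lt_const hm
  filter_upwards [this] with r hr using loc m r hr

theorem isCharacteristic (h : IsVelocity V W N M) (t x : ℝ) :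
    IsCharacteristic V t x (characteristic V t x) :=
  Classical.epsilon_spec (h.exists_characteristic t x)

theorem continuous_characteristic (h : IsVelocity V W N M) (t x : ℝ) :
    Continuous (characteristic V t x) :=
  continuous_iff_continuousAt.2 fun s => ((h.isCharacteristic t x).2 s).continuousAt

/-- The difference of two characteristics. -/
theorem characteristic_sub (h : IsVelocity V W N M) (t x t₀ x₀ s : ℝ) :
    characteristic V t x s - characteristic V t₀ x₀ s = (x - characteristic V t₀ x₀ t) *
      Real.exp (∫ r in t..s, avgSlope W r (characteristic V t x r) (characteristic V t₀ x₀ r)) := by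
  have hm : Continuous fun r =>
      avgSlope W r (characteristic V t x r) (characteristic V t₀ x₀ r) :=
    (continuous_avgSlope h.cont_deriv).comp (continuous_id.prodMk
      ((h.continuous_characteristic t x).prodMk (h.continuous_characteristic t₀ x₀)))
  have := eq_mul_exp_of_hasDerivAt (D := fun s => characteristic V t x s - characteristic V t₀ x₀ s)
    hm (fun s => (((h.isCharacteristic t x).2 s).sub ((h.isCharacteristic t₀ x₀).2 s)).congr_deriv
      (h.sub_eq_avgSlope_mul _ _ _)) t s
  rw [this, (h.isCharacteristic t x).1]

theorem abs_characteristic_sub_le (h : IsVelocity V W N M) (t x t₀ x₀ s : ℝ) :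
    |characteristic V t x s - characteristic V t₀ x₀ s| ≤
      |x - characteristic V t₀ x₀ t| * Real.exp (M * |s - t|) := by
  rw [h.characteristic_sub, abs_mul, Real.abs_exp]
  refine mul_le_mul_of_nonneg_left (Real.exp_le_exp.2 ((le_abs_self _).trans ?_)) (abs_nonneg _)
  exact intervalIntegral.norm_integral_le_of_norm_le_const (C := M) (a := t) (b := s)
    (f := fun r => avgSlope W r (characteristic V t x r) (characteristic V t₀ x₀ r))
    fun r _ => h.abs_avgSlope_le _ _ _

theorem continuous_characteristic_uncurry (h : IsVelocity V W N M) :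
    Continuous fun p : (ℝ × ℝ) × ℝ => characteristic V p.1.1 p.1.2 p.2 := by
  refine continuous_iff_continuousAt.2 fun ⟨⟨t₀, x₀⟩, s₀⟩ => ?_
  have hc := h.continuous_characteristic t₀ x₀
  -- The distance to the base value is split through the fixed characteristic from `(t₀, x₀)`,
  -- evaluated at the moving time `p.2`.
  have hb : Continuous fun p : (ℝ × ℝ) × ℝ =>
      |p.1.2 - characteristic V t₀ x₀ p.1.1| * Real.exp (M * |p.2 - p.1.1|)
        + |characteristic V t₀ x₀ p.2 - characteristic V t₀ x₀ s₀| := by fun_prop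
  have h0 := hb.tendsto ((t₀, x₀), s₀)
  simp only [(h.isCharacteristic t₀ x₀).1, sub_self, abs_zero, zero_mul, add_zero] at h0
  refine tendsto_iff_dist_tendsto_zero.2 (squeeze_zero (fun _ => dist_nonneg) (fun p => ?_) h0)
  rw [Real.dist_eq]
  refine (abs_sub_le _ (characteristic V t₀ x₀ p.2) _).trans ?_
  gcongr
  exact h.abs_characteristic_sub_le _ _ _ _ _

theorem backFlow_zero (h : IsVelocity V W N M) (x : ℝ) : backFlow V 0 x = x :=
  (h.isCharacteristic 0 x).1

theorem abs_backFlow_sub_le (h : IsVelocity V W N M) (t x x' : ℝ) :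
    |backFlow V t x - backFlow V t x'| ≤ |x - x'| * Real.exp (M * |t|) := by
  have := h.abs_characteristic_sub_le t x t x' 0
  rwa [(h.isCharacteristic t x').1, zero_sub, abs_neg] at this

/-- The derivative of `backFlow V` in time and space. -/
theorem hasFDerivAt_backFlow (h : IsVelocity V W N M) (p : ℝ × ℝ) :
    HasFDerivAt (fun q : ℝ × ℝ => backFlow V q.1 q.2)
      (Real.exp (-∫ r in (0 : ℝ)..p.1, W r (characteristic V p.1 p.2 r)) •
        (ContinuousLinearMap.snd ℝ ℝ ℝ - V p.1 p.2 • ContinuousLinearMap.fst ℝ ℝ ℝ)) p := by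
  obtain ⟨t₀, x₀⟩ := p
  have hγ := h.isCharacteristic t₀ x₀
  -- Up to a constant, `backFlow` is a factor differentiable at `(t₀, x₀)` and vanishing there,
  -- times a merely continuous exponential. Such a product is differentiable at that point, so the
  -- exponential need not be differentiated.
  have e : (fun q : ℝ × ℝ => backFlow V q.1 q.2) = fun q => (q.2 - characteristic V t₀ x₀ q.1) *
      Real.exp (-∫ r in (0 : ℝ)..q.1,
        avgSlope W r (characteristic V q.1 q.2 r) (characteristic V t₀ x₀ r))
      + characteristic V t₀ x₀ 0 := by
    funext q
    rw [← intervalIntegral.integral_symm, ← h.characteristic_sub, backFlow]; ring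
  have hg : HasFDerivAt (fun q : ℝ × ℝ => q.2 - characteristic V t₀ x₀ q.1)
      (ContinuousLinearMap.snd ℝ ℝ ℝ - V t₀ x₀ • ContinuousLinearMap.fst ℝ ℝ ℝ) (t₀, x₀) := by
    have hd := hγ.2 t₀
    rw [hγ.1] at hd
    exact hasFDerivAt_snd.sub (hd.comp_hasFDerivAt (t₀, x₀) hasFDerivAt_fst)
  have hm : Continuous fun q : (ℝ × ℝ) × ℝ =>
      avgSlope W q.2 (characteristic V q.1.1 q.1.2 q.2) (characteristic V t₀ x₀ q.2) :=
    (continuous_avgSlope h.cont_deriv).comp (continuous_snd.prodMk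
      (h.continuous_characteristic_uncurry.prodMk
        ((h.continuous_characteristic t₀ x₀).comp continuous_snd)))
  have hI := intervalIntegral.continuous_parametric_intervalIntegral_of_continuous
    (f := fun (q : ℝ × ℝ) r =>
      avgSlope W r (characteristic V q.1 q.2 r) (characteristic V t₀ x₀ r)) (a₀ := 0)
      (μ := MeasureTheory.volume) hm continuous_fst
  rw [e]
  refine HasFDerivAt.add_const _ ?_
  have := hg.mul_of_eq_zero (by simp [hγ.1]) (Real.continuous_exp.comp hI.neg).continuousAt
  simpa [avgSlope_self, Function.comp_def] using this

theorem contDiff_backFlow (h : IsVelocity V W N M) :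
    ContDiff ℝ 1 fun q : ℝ × ℝ => backFlow V q.1 q.2 := by
  refine contDiff_one_iff_hasFDerivAt.2 ⟨_, ?_, h.hasFDerivAt_backFlow⟩
  have hI := intervalIntegral.continuous_parametric_intervalIntegral_of_continuous
    (f := fun (q : ℝ × ℝ) r => W r (characteristic V q.1 q.2 r)) (a₀ := 0)
      (μ := MeasureTheory.volume)
      (h.cont_deriv.comp (continuous_snd.prodMk h.continuous_characteristic_uncurry)) continuous_fst
  have := h.cont
  fun_prop

/-- `backFlow V` solves the transport equation with velocity `V`, and is Lipschitz in space. -/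
theorem exists_hasDerivAt_backFlow (h : IsVelocity V W N M) (t x : ℝ) :
    ∃ e : ℝ, |e| ≤ Real.exp (M * |t|) ∧ HasDerivAt (backFlow V t) e x ∧
      HasDerivAt (fun s => backFlow V s x) (-(V t x * e)) t := by
  refine ⟨Real.exp (-∫ r in (0 : ℝ)..t, W r (characteristic V t x r)), ?_, ?_, ?_⟩
  · rw [Real.abs_exp]
    refine Real.exp_le_exp.2 ((neg_le_abs _).trans ?_)
    simpa using intervalIntegral.norm_integral_le_of_norm_le_const (a := 0) (b := t)
      (f := fun r => W r (characteristic V t x r)) (fun r _ => h.abs_deriv_le _ _)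
  · simpa [Function.comp_def] using (h.hasFDerivAt_backFlow (t, x)).comp_hasDerivAt (f := fun x => (t, x)) x
      ((hasDerivAt_const x t).prodMk (hasDerivAt_id x))
  · refine ((h.hasFDerivAt_backFlow (t, x)).comp_hasDerivAt (f := fun s => (s, x)) t
      ((hasDerivAt_id t).prodMk (hasDerivAt_const t x))).congr_deriv ?_
    simp; ring

/-- Dependence of `backFlow` on the velocity. -/
theorem abs_backFlow_sub_backFlow_le {V' W' : ℝ → ℝ → ℝ} {N' M' : ℝ} (h : IsVelocity V W N M)
    (h' : IsVelocity V' W' N' M') {ε T : ℝ} (hε : ∀ t x, |V t x - V' t x| ≤ ε) {t : ℝ}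
    (ht : t ∈ Icc 0 T) (x : ℝ) :
    |backFlow V t x - backFlow V' t x| ≤ ε * Real.exp (M * T) * T := by
  have hγ := h.isCharacteristic t x
  have hγ' := h'.isCharacteristic t x
  -- Adding and subtracting `V` along the second characteristic leaves a linear term in the
  -- difference and a source `V - V'`.
  refine abs_le_of_hasDerivAt_linear (D := fun s => characteristic V t x s - characteristic V' t x s)
    (m := fun r => avgSlope W r (characteristic V t x r) (characteristic V' t x r))
    (r := fun s => V s (characteristic V' t x s) - V' s (characteristic V' t x s))
    ?_ (fun s => h.abs_avgSlope_le _ _ _) (fun s => hε _ _) (fun s => ?_) ht ?_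
  · exact (continuous_avgSlope h.cont_deriv).comp (continuous_id.prodMk
      ((h.continuous_characteristic t x).prodMk (h'.continuous_characteristic t x)))
  · refine ((hγ.2 s).sub (hγ'.2 s)).congr_deriv ?_
    rw [← h.sub_eq_avgSlope_mul]; ring
  · simp [hγ.1, hγ'.1]

/-- If `V ≥ l - b` then characteristics move to the right by at least `∫ l - b t`. -/
theorem backFlow_le (h : IsVelocity V W N M) {l : ℝ → ℝ} (hl : Continuous l) {b : ℝ}
    (hb : ∀ t x, l t - b ≤ V t x) {t : ℝ} (ht : 0 ≤ t) (x : ℝ) :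
    backFlow V t x ≤ x - ((∫ s in (0 : ℝ)..t, l s) - b * t) := by
  have hγ := h.isCharacteristic t x
  have hVc : Continuous fun s => V s (characteristic V t x s) :=
    h.cont.comp (continuous_id.prodMk (h.continuous_characteristic t x))
  have h1 := intervalIntegral.integral_eq_sub_of_hasDerivAt (a := 0) (b := t) (fun s _ => hγ.2 s)
    (hVc.intervalIntegrable _ _)
  have h2 : (∫ s in (0 : ℝ)..t, (l s - b)) ≤ ∫ s in (0 : ℝ)..t, V s (characteristic V t x s) :=
    intervalIntegral.integral_mono_on ht ((hl.sub continuous_const).intervalIntegrable _ _)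
      (hVc.intervalIntegrable _ _) (fun s _ => hb _ _)
  rw [intervalIntegral.integral_sub (hl.intervalIntegrable _ _) (by simp), h1, hγ.1] at h2
  simp only [intervalIntegral.integral_const, sub_zero, smul_eq_mul] at h2
  unfold backFlow
  linarith

end IsVelocity

/-! ### Sup norms and extension of the initial datum -/

theorem le_supNormOn {X : Type*} [TopologicalSpace X] {s : Set X} {f : X → ℝ} (hs : IsCompact s)
    (hf : ContinuousOn f s) {x : X} (hx : x ∈ s) : |f x| ≤ supNormOn s f :=
  le_csSup (hs.image_of_continuousOn hf.abs).bddAbove (mem_image_of_mem _ hx)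

theorem supNormOn_le {X : Type*} {s : Set X} {f : X → ℝ} {c : ℝ} (hs : s.Nonempty)
    (h : ∀ x ∈ s, |f x| ≤ c) : supNormOn s f ≤ c :=
  csSup_le (hs.image _) (by rintro _ ⟨x, hx, rfl⟩; exact h x hx)

theorem supNormOn_nonneg {X : Type*} (s : Set X) (f : X → ℝ) : 0 ≤ supNormOn s f :=
  Real.sSup_nonneg (by rintro _ ⟨x, _, rfl⟩; exact abs_nonneg _)

theorem c1NormInterval_nonneg (L : ℝ) (f : ℝ → ℝ) : 0 ≤ c1NormInterval L f :=
  add_nonneg (supNormOn_nonneg _ _) (supNormOn_nonneg _ _)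

/-- A `C^1` function on `[0, L]` has a `C^1` extension to `ℝ` that vanishes to the left of `-ε`,
with linear control of the norm. -/
theorem exists_c1_extension {L ε : ℝ} (hL : 0 < L) (hε : 0 < ε) :
    ∃ K : ℝ, 0 < K ∧ ∀ f : ℝ → ℝ, ContDiffOn ℝ 1 f (Icc 0 L) → ∃ g g' : ℝ → ℝ,
      (∀ x, HasDerivAt g (g' x) x) ∧ Continuous g' ∧ (∀ x ∈ Icc 0 L, g x = f x) ∧
      (∀ x ≤ -ε, g x = 0) ∧ (∀ x, |g x| ≤ K * c1NormInterval L f) ∧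
      ∀ x, |g' x| ≤ K * c1NormInterval L f := by
  -- The cutoff is `1` on `[0, L]` and vanishes outside `(-ε, L + ε)`.
  let χ : ContDiffBump (L / 2) := ⟨L / 2, L / 2 + ε, by positivity, by linarith⟩
  have hχ : ContDiff ℝ 1 χ := χ.contDiff
  have hχd : ∀ x, HasDerivAt χ (deriv χ x) x := fun x =>
    (hχ.differentiable one_ne_zero x).hasDerivAt
  have hχc : Continuous (deriv χ) := hχ.continuous_deriv le_rfl
  have hsupp : tsupport χ = Metric.closedBall (L / 2) (L / 2 + ε) := χ.tsupport_eq
  obtain ⟨B, hB⟩ := χ.hasCompactSupport.deriv.exists_bound_of_continuous hχc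
  have hB0 : 0 ≤ B := (norm_nonneg _).trans (hB 0)
  refine ⟨(B + 1) * (1 + L + ε), by positivity, fun f hf => ?_⟩
  set n := c1NormInterval L f with hn
  have hn0 : 0 ≤ n := c1NormInterval_nonneg L f
  have hfc : ContinuousOn (derivWithin f (Icc 0 L)) (Icc 0 L) :=
    hf.continuousOn_derivWithin (uniqueDiffOn_Icc hL) le_rfl
  have h0 : |f 0| ≤ n := (le_supNormOn isCompact_Icc hf.continuousOn (left_mem_Icc.2 hL.le)).trans
    (le_add_of_nonneg_right (supNormOn_nonneg _ _))
  have h1 : ∀ x ∈ Icc 0 L, |derivWithin f (Icc 0 L) x| ≤ n := fun x hx =>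
    (le_supNormOn isCompact_Icc hfc hx).trans (le_add_of_nonneg_left (supNormOn_nonneg _ _))
  -- Freezing the derivative outside `[0, L]` makes its primitive `e` continue `f` affinely; the
  -- linear growth of `e` is harmless because only its values on the support of `χ` matter.
  let d : ℝ → ℝ := fun x => derivWithin f (Icc 0 L) (clampPoint L x)
  have hd : Continuous d := hfc.comp_continuous continuous_clampPoint (clampPoint_mem hL)
  have hdn : ∀ x, |d x| ≤ n := fun x => h1 _ (clampPoint_mem hL x)
  let e : ℝ → ℝ := fun x => f 0 + ∫ s in (0 : ℝ)..x, d s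
  have he : ∀ x, HasDerivAt e (d x) x := fun x =>
    (hd.integral_hasStrictDerivAt 0 x).hasDerivAt.const_add _
  have hec : Continuous e := continuous_iff_continuousAt.2 fun x => (he x).continuousAt
  have hen : ∀ x, χ x ≠ 0 ∨ deriv χ x ≠ 0 → |e x| ≤ (1 + L + ε) * n := by
    intro x hx
    have hx' : x ∈ tsupport χ := hx.elim (fun h => subset_tsupport _ h)
      (fun h => support_deriv_subset h)
    rw [hsupp, Metric.mem_closedBall, Real.dist_eq, abs_le] at hx'
    have hi : |∫ s in (0 : ℝ)..x, d s| ≤ n * |x - 0| :=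
      intervalIntegral.norm_integral_le_of_norm_le_const (f := d) (C := n) fun s _ => hdn s
    have : |x - 0| ≤ L + ε := by
      rw [sub_zero, abs_le]; constructor <;> linarith [hx'.1, hx'.2]
    have := mul_le_mul_of_nonneg_left this hn0
    linarith [abs_add_le (f 0) (∫ s in (0 : ℝ)..x, d s)]
  have hb : 0 ≤ (1 + L + ε) * n := by positivity
  have hχ1 : ∀ x, |χ x| ≤ 1 := fun x => abs_le.2 ⟨by linarith [χ.nonneg' x], χ.le_one⟩
  refine ⟨fun x => χ x * e x, fun x => deriv χ x * e x + χ x * d x, fun x => (hχd x).mul (he x),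
    (hχc.mul hec).add (χ.continuous.mul hd), fun x hx => ?_, fun x hx => ?_, fun x => ?_, fun x => ?_⟩
  · have hχx : χ x = 1 := χ.one_of_mem_closedBall (by
      change dist x (L / 2) ≤ L / 2
      rw [Real.dist_eq, abs_le]; constructor <;> linarith [hx.1, hx.2])
    have key : (∫ s in (0 : ℝ)..x, d s) = f x - f 0 := by
      refine intervalIntegral.integral_eq_sub_of_hasDerivAt_of_le hx.1
        (hf.continuousOn.mono (Icc_subset_Icc_right hx.2)) (fun s hs => ?_)
        (hd.intervalIntegrable _ _)
      have hs' : s ∈ Icc 0 L := ⟨hs.1.le, hs.2.le.trans hx.2⟩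
      simp only [d, clampPoint_of_mem hs']
      exact (hf.differentiableOn one_ne_zero s hs').hasDerivWithinAt.hasDerivAt
        (Icc_mem_nhds hs.1 (hs.2.trans_le hx.2))
    simp only [e, hχx, key]; ring
  · have : χ x = 0 := χ.zero_of_le_dist (by
      rw [Real.dist_eq, abs_sub_comm, abs_of_nonneg (by linarith)]
      change L / 2 + ε ≤ _
      linarith)
    simp [this]
  · by_cases hx : χ x = 0
    · simp only [hx, zero_mul, abs_zero]; positivity
    · rw [abs_mul]
      calc |χ x| * |e x| ≤ 1 * ((1 + L + ε) * n) :=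
            mul_le_mul (hχ1 x) (hen x (.inl hx)) (abs_nonneg _) zero_le_one
        _ ≤ (B + 1) * (1 + L + ε) * n := by nlinarith
  · have a1 : |deriv χ x * e x| ≤ B * ((1 + L + ε) * n) := by
      by_cases hx : deriv χ x = 0
      · simp only [hx, zero_mul, abs_zero]; positivity
      · rw [abs_mul]
        exact mul_le_mul (hB x) (hen x (.inr hx)) (abs_nonneg _) hB0
    have a2 : |χ x * d x| ≤ 1 * n := by
      rw [abs_mul]; exact mul_le_mul (hχ1 x) (hdn x) (abs_nonneg _) zero_le_one
    have a3 : 0 ≤ (L + ε) * n := by positivity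
    linarith [abs_add_le (deriv χ x * e x) (χ x * d x)]

/-- The equation itself expresses the second derivative as the continuous function `α⁻² (z - y)`. -/
theorem contDiff_two_helmholtz {α L : ℝ} {y : ℝ → ℝ} (hy : Continuous y) :
    ContDiff ℝ 2 (helmholtz α L y) := by
  have h1 : deriv (helmholtz α L y) = helmholtzDeriv α L y :=
    funext fun x => (hasDerivAt_helmholtz hy x).deriv
  have h2 : deriv (helmholtzDeriv α L y) = fun x => α⁻¹ ^ 2 * (helmholtz α L y x - y x) :=
    funext fun x => (hasDerivAt_helmholtzDeriv hy x).deriv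
  have hd : Differentiable ℝ (helmholtz α L y) := fun x => (hasDerivAt_helmholtz hy x).differentiableAt
  rw [show (2 : WithTop ℕ∞) = 1 + 1 by norm_num, contDiff_succ_iff_deriv]
  refine ⟨hd, by simp, ?_⟩
  rw [h1, contDiff_one_iff_deriv, h2]
  exact ⟨fun x => (hasDerivAt_helmholtzDeriv hy x).differentiableAt,
    continuous_const.mul (hd.continuous.sub hy)⟩

/-! ### The nonlocal velocity and the fixed point -/

/-- The transport velocity `l + z`, where `z` is the filtered state, extended from `[0, L]`. -/
noncomputable def filteredVelocity (α L : ℝ) (l : ℝ → ℝ) (y : ℝ → ℝ → ℝ) (t x : ℝ) : ℝ :=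
  l t + foldExt L (helmholtz α L (y t)) x

/-- States of amplitude at most `b` that are `1`-Lipschitz in space. -/
structure IsTameState (b : ℝ) (y : ℝ → ℝ → ℝ) : Prop where
  cont : Continuous fun p : ℝ × ℝ => y p.1 p.2
  abs_le : ∀ t x, |y t x| ≤ b
  lip : ∀ t x x', |y t x - y t x'| ≤ |x - x'|

section FixedPoint

variable {α L Λ b : ℝ} {l : ℝ → ℝ} {y : ℝ → ℝ → ℝ}

theorem IsTameState.continuous (h : IsTameState b y) (t : ℝ) : Continuous (y t) :=
  h.cont.comp (by fun_prop : Continuous fun x : ℝ => (t, x))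

theorem IsTameState.abs_filteredVelocity_sub_le (h : IsTameState b y) (hα : 0 < α) (hL : 0 < L)
    (t x : ℝ) : |filteredVelocity α L l y t x - l t| ≤ 3 * b := by
  rw [filteredVelocity, add_sub_cancel_left]
  exact abs_foldExt_le hL (abs_helmholtz_le hα hL (h.continuous t) fun x _ => h.abs_le t x) x

/-- The bounds do not involve `α`. The space derivative is that of `z` at a folded point times a
slope in `[0, 1]`, hence the constant `1`, while the amplitude of the extension costs the factor
`3`. -/
theorem IsTameState.isVelocity (h : IsTameState b y) (hα : 0 < α) (hL : 0 < L) (hl : Continuous l)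
    (hΛ : ∀ t, |l t| ≤ Λ) :
    IsVelocity (filteredVelocity α L l y)
      (fun t x => helmholtzDeriv α L (y t) (foldPoint L x) * foldSlope L x) (Λ + 3 * b) 1 := by
  obtain ⟨hz, hz'⟩ := continuous_helmholtz (α := α) (L := L) h.cont
  have hp : Continuous fun p : ℝ × ℝ => (p.1, clampPoint L p.2) :=
    continuous_fst.prodMk (continuous_clampPoint.comp continuous_snd)
  have hq : Continuous fun p : ℝ × ℝ => (p.1, foldPoint L p.2) :=
    continuous_fst.prodMk (continuous_foldPoint.comp continuous_snd)
  refine ⟨?_, ?_, fun t x => ?_, fun t x => ?_, fun t x => ?_⟩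
  · have h1 : Continuous fun p : ℝ × ℝ => helmholtz α L (y p.1) (clampPoint L p.2) := by
      simpa only [Function.comp_def] using hz.comp hp
    have h2 : Continuous fun p : ℝ × ℝ => helmholtz α L (y p.1) (foldPoint L p.2) := by
      simpa only [Function.comp_def] using hz.comp hq
    unfold filteredVelocity foldExt
    exact (hl.comp continuous_fst).add ((continuous_const.mul h1).sub h2)
  · have h1 : Continuous fun p : ℝ × ℝ => helmholtzDeriv α L (y p.1) (foldPoint L p.2) := by
      simpa only [Function.comp_def] using hz'.comp hq
    exact h1.mul (continuous_foldSlope.comp continuous_snd)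
  · exact (hasDerivAt_foldExt hL (hasDerivAt_helmholtz (h.continuous t)) x).const_add (l t)
  · have := abs_add_le (l t) (filteredVelocity α L l y t x - l t)
    rw [add_sub_cancel] at this
    linarith [hΛ t, h.abs_filteredVelocity_sub_le (l := l) hα hL t x]
  · have hs := foldSlope_mem L x hL
    rw [abs_mul, abs_of_nonneg hs.1]
    refine mul_le_one₀ (abs_helmholtzDeriv_le hα hL (h.continuous t) (M := 1)
      (fun a a' => by rw [one_mul]; exact h.lip t a a') _ (foldPoint_mem hL x)) hs.1 hs.2

theorem abs_filteredVelocity_sub_filteredVelocity_le {y' : ℝ → ℝ → ℝ} {b' d : ℝ}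
    (h : IsTameState b y) (h' : IsTameState b' y') (hα : 0 < α) (hL : 0 < L)
    (hd : ∀ t x, |y t x - y' t x| ≤ d) (t x : ℝ) :
    |filteredVelocity α L l y t x - filteredVelocity α L l y' t x| ≤ 3 * d := by
  have := abs_foldExt_le hL (abs_helmholtz_le (α := α) hα hL ((h.continuous t).sub (h'.continuous t))
    (c := d) fun x _ => hd t x) x
  convert this using 2
  have e := helmholtz_sub (α := α) (L := L) (h.continuous t) (h'.continuous t)
  change _ = foldExt L (helmholtz α L (fun x => y t x - y' t x)) x
  simp only [filteredVelocity, foldExt, e]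
  ring

/-- The nonlocal transport equation has a solution of the form `g ∘ backFlow`. -/
theorem exists_fixedPoint_transport {T G : ℝ} {g : ℝ → ℝ} (hα : 0 < α) (hL : 0 < L) (hT : 0 < T)
    (hl : Continuous l) (hΛ : ∀ t, |l t| ≤ Λ) (hg : ∀ x, |g x| ≤ b)
    (hgG : ∀ x x', |g x - g x'| ≤ G * |x - x'|) (hG1 : G * Real.exp T ≤ 1)
    (hG2 : G * (3 * Real.exp T * T) ≤ 1 / 2) :
    ∃ y, IsTameState b y ∧
      ∀ t ∈ Icc 0 T, ∀ x, y t x = g (backFlow (filteredVelocity α L l y) t x) := by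
  have hb : 0 ≤ b := (abs_nonneg _).trans (hg 0)
  have hG : 0 ≤ G := by simpa using (abs_nonneg _).trans (hgG 1 0)
  have hgc : Continuous g := (LipschitzWith.of_dist_le_mul (K := G.toNNReal) fun x x' => by
    rw [Real.coe_toNNReal _ hG]; exact hgG x x').continuous
  -- Amplitude and Lipschitz bounds survive uniform limits, so this set is complete for the sup
  -- norm.
  let S : Set (ℝ × ℝ →ᵇ ℝ) := {f | (∀ p, |f p| ≤ b) ∧ ∀ t x x', |f (t, x) - f (t, x')| ≤ |x - x'|}
  have hS : IsClosed S := by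
    have ev : ∀ p : ℝ × ℝ, Continuous fun f : ℝ × ℝ →ᵇ ℝ => f p := fun p =>
      continuous_eval_const p
    have e : S = (⋂ p : ℝ × ℝ, {f | |f p| ≤ b}) ∩
        ⋂ (t : ℝ) (x : ℝ) (x' : ℝ), {f | |f (t, x) - f (t, x')| ≤ |x - x'|} := by
      ext f; simp [S]
    rw [e]
    exact (isClosed_iInter fun p => isClosed_le (ev p).abs continuous_const).inter
      (isClosed_iInter fun t => isClosed_iInter fun x => isClosed_iInter fun x' =>
        isClosed_le ((ev _).sub (ev _)).abs continuous_const)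
  have : CompleteSpace S := hS.completeSpace_coe
  have : Nonempty S := ⟨⟨0, fun p => by simpa using hb, fun t x x' => by simp⟩⟩
  let st : S → ℝ → ℝ → ℝ := fun f t x => f.1 (t, x)
  have tame : ∀ f : S, IsTameState b (st f) := fun f =>
    ⟨f.1.continuous, fun t x => f.2.1 (t, x), f.2.2⟩
  have vel := fun f : S => (tame f).isVelocity hα hL hl hΛ
  -- Clamping time to `[0, T]` bounds the growth of the flow by `exp T`, so the map acts on
  -- functions defined for all times.
  let A : S → ℝ × ℝ → ℝ := fun f p =>
    backFlow (filteredVelocity α L l (st f)) (clampPoint T p.1) p.2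
  have hAc : ∀ f, Continuous (A f) := fun f => (vel f).contDiff_backFlow.continuous.comp
    ((continuous_clampPoint.comp continuous_fst).prodMk continuous_snd)
  have hcl : ∀ t, |clampPoint T t| ≤ T := fun t => by
    rw [abs_of_nonneg (clampPoint_mem hT t).1]; exact (clampPoint_mem hT t).2
  let Φ : S → S := fun f =>
    ⟨BoundedContinuousFunction.ofNormedAddCommGroup (fun p => g (A f p)) (hgc.comp (hAc f)) b
      (fun p => hg _), fun p => hg _, fun t x x' => by
        have h1 := (vel f).abs_backFlow_sub_le (clampPoint T t) x x'
        have h2 : Real.exp (1 * |clampPoint T t|) ≤ Real.exp T :=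
          Real.exp_le_exp.2 (by rw [one_mul]; exact hcl t)
        calc |g (A f (t, x)) - g (A f (t, x'))| ≤ G * |A f (t, x) - A f (t, x')| := hgG _ _
          _ ≤ G * (|x - x'| * Real.exp T) := by
            gcongr; exact h1.trans (mul_le_mul_of_nonneg_left h2 (abs_nonneg _))
          _ = G * Real.exp T * |x - x'| := by ring
          _ ≤ |x - x'| := mul_le_of_le_one_left (abs_nonneg _) hG1⟩
  -- The factor `3` comes from the folded extension, `exp T * T` from stability of the flow, and `G`
  -- from the Lipschitz bound of `g`.
  have hΦ : ContractingWith (1 / 2) Φ := by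
    refine ⟨by norm_num, LipschitzWith.of_dist_le_mul fun f h => ?_⟩
    have hd : ∀ t x, |st f t x - st h t x| ≤ dist f h := fun t x =>
      BoundedContinuousFunction.dist_coe_le_dist (f := f.1) (g := h.1) (t, x)
    refine (BoundedContinuousFunction.dist_le (by positivity)).2 fun p => ?_
    have hA := (vel f).abs_backFlow_sub_backFlow_le (vel h)
      (abs_filteredVelocity_sub_filteredVelocity_le (tame f) (tame h) hα hL hd)
      (clampPoint_mem hT p.1) p.2
    rw [one_mul] at hA
    calc |g (A f p) - g (A h p)| ≤ G * |A f p - A h p| := hgG _ _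
      _ ≤ G * (3 * dist f h * Real.exp T * T) := mul_le_mul_of_nonneg_left hA hG
      _ = G * (3 * Real.exp T * T) * dist f h := by ring
      _ ≤ 1 / 2 * dist f h := mul_le_mul_of_nonneg_right hG2 dist_nonneg
      _ = _ := by norm_num
  refine ⟨st (hΦ.fixedPoint Φ), tame _, fun t ht x => ?_⟩
  have hfix : Φ (hΦ.fixedPoint Φ) = hΦ.fixedPoint Φ := hΦ.fixedPoint_isFixedPt
  have := DFunLike.congr_fun (congrArg Subtype.val hfix) (t, x)
  refine this.symm.trans ?_
  change g (backFlow _ (clampPoint T t) x) = _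
  rw [clampPoint_of_mem ht]

end FixedPoint

/-! ### Null controllability and the choice of constants -/

theorem c1NormRect_le {T L b₀ b₁ b₂ : ℝ} {u u₁ u₂ : ℝ → ℝ → ℝ} (hT : 0 < T) (hL : 0 < L)
    (h₁ : ∀ t x, HasDerivAt (fun s => u s x) (u₁ t x) t) (h₂ : ∀ t x, HasDerivAt (u t) (u₂ t x) x)
    (e₀ : ∀ t ∈ Icc 0 T, ∀ x ∈ Icc 0 L, |u t x| ≤ b₀)
    (e₁ : ∀ t ∈ Icc 0 T, ∀ x ∈ Icc 0 L, |u₁ t x| ≤ b₁)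
    (e₂ : ∀ t ∈ Icc 0 T, ∀ x ∈ Icc 0 L, |u₂ t x| ≤ b₂) : c1NormRect T L u ≤ b₀ + b₁ + b₂ := by
  have hne : (Icc 0 T ×ˢ Icc 0 L : Set (ℝ × ℝ)).Nonempty :=
    (nonempty_Icc.2 hT.le).prod (nonempty_Icc.2 hL.le)
  refine add_le_add (add_le_add (supNormOn_le hne fun p hp => e₀ _ hp.1 _ hp.2)
    (supNormOn_le hne fun p hp => ?_)) (supNormOn_le hne fun p hp => ?_)
  · rw [(h₁ p.1 p.2).hasDerivWithinAt.derivWithin (uniqueDiffOn_Icc hT _ hp.1)]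
    exact e₁ _ hp.1 _ hp.2
  · rw [(h₂ p.1 p.2).hasDerivWithinAt.derivWithin (uniqueDiffOn_Icc hL _ hp.2)]
    exact e₂ _ hp.1 _ hp.2

/-- Null controllability for an extended initial state `g` that is small compared with the
transport time. -/
theorem exists_isNullControlledState {T L α Λ b η : ℝ} {lam l y0 g g' : ℝ → ℝ} (hT : 0 < T)
    (hL : 0 < L) (hα : 0 < α) (hl : Continuous l) (hΛ : ∀ t, |l t| ≤ Λ)
    (hlam : ∀ t ∈ Icc 0 T, l t = lam t) (hint : L + η ≤ ∫ t in (0 : ℝ)..T, l t)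
    (hg : ∀ x, HasDerivAt g (g' x) x) (hg' : Continuous g') (hgy : ∀ x ∈ Icc 0 L, g x = y0 x)
    (hg0 : ∀ x ≤ -(η / 2), g x = 0) (hb : ∀ x, |g x| ≤ b) (hb' : ∀ x, |g' x| ≤ b)
    (h1 : b * Real.exp T ≤ 1) (h2 : b * (3 * Real.exp T * T) ≤ 1 / 2) (h3 : 3 * b * T ≤ η / 2) :
    ∃ vl vr : ℝ → ℝ, ContDiffOn ℝ 1 vl (Icc 0 T) ∧ ContDiffOn ℝ 1 vr (Icc 0 T) ∧
      ∃ y z : ℝ → ℝ → ℝ, IsNullControlledState T L α lam y0 vl vr y z ∧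
        c1NormRect T L y ≤ b + b * ((Λ + 3 * b) * Real.exp T) + b * Real.exp T := by
  have hb0 : 0 ≤ b := (abs_nonneg _).trans (hb 0)
  have hgL : ∀ x x', |g x - g x'| ≤ b * |x - x'| := fun x x' =>
    convex_univ.norm_image_sub_le_of_norm_hasDerivWithin_le
      (fun z _ => (hg z).hasDerivWithinAt) (fun z _ => hb' z) (mem_univ x') (mem_univ x)
  obtain ⟨w, hw, hfix⟩ := exists_fixedPoint_transport (α := α) hα hL hT hl hΛ hb hgL h1 h2
  set V := filteredVelocity α L l w with hV
  have vel := hw.isVelocity (α := α) hα hL hl hΛ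
  set y : ℝ → ℝ → ℝ := fun t x => g (backFlow V t x) with hy
  -- The fixed point `w` is only known to be continuous. The state `y` is `C^1` on the whole plane
  -- and coincides with `w` for the times that matter.
  have hyw : ∀ t ∈ Icc 0 T, w t = y t := fun t ht => funext (hfix t ht)
  choose e he hex het using vel.exists_hasDerivAt_backFlow
  have hy1 : ∀ t x, HasDerivAt (fun s => y s x) (g' (backFlow V t x) * -(V t x * e t x)) t :=
    fun t x => (hg _).comp t (het t x)
  have hy2 : ∀ t x, HasDerivAt (y t) (g' (backFlow V t x) * e t x) x :=
    fun t x => (hg _).comp x (hex t x)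
  have hgC : ContDiff ℝ 1 g := contDiff_one_iff_deriv.2
    ⟨fun x => (hg x).differentiableAt, by rwa [show deriv g = g' from funext fun x => (hg x).deriv]⟩
  have hyC : ContDiff ℝ 1 fun p : ℝ × ℝ => y p.1 p.2 := hgC.comp vel.contDiff_backFlow
  have hyc : ∀ t, Continuous (y t) := fun t =>
    continuous_iff_continuousAt.2 fun x => (hy2 t x).continuousAt
  have hyv : ∀ a, ContDiffOn ℝ 1 (fun t => y t a) (Icc 0 T) := fun a =>
    (hyC.comp (contDiff_id.prodMk contDiff_const : ContDiff ℝ 1 fun t : ℝ => (t, a))).contDiffOn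
  have hE : ∀ t ∈ Icc 0 T, ∀ x, |e t x| ≤ Real.exp T := fun t ht x => (he t x).trans
    (Real.exp_le_exp.2 (by rw [one_mul, abs_of_nonneg ht.1]; exact ht.2))
  refine ⟨fun t => y t 0, fun t => y t L, hyv 0, hyv L, y, fun t => helmholtz α L (y t), ?_, ?_⟩
  · refine ⟨hyC.contDiffOn, (contDiff_helmholtz hyC).contDiffOn,
      fun t _ => (contDiff_two_helmholtz (hyc t)).contDiffOn, fun t ht x hx => ?_, fun t _ x _ => ?_,
      fun t _ => ⟨rfl, helmholtz_zero⟩, fun t _ => ⟨rfl, helmholtz_right hα hL⟩, fun x hx => ?_,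
      fun x hx => ?_⟩
    · have ht' := Ioo_subset_Icc_self ht
      have hVt : V t x = lam t + helmholtz α L (y t) x := by
        rw [hV, filteredVelocity, foldExt_of_mem (Ioo_subset_Icc_self hx), hlam t ht', hyw t ht']
      rw [(hy1 t x).deriv, (hy2 t x).deriv, ← hVt]
      ring
    · have hd : deriv (helmholtz α L (y t)) = helmholtzDeriv α L (y t) :=
        funext fun x => (hasDerivAt_helmholtz (hyc t) x).deriv
      rw [hd, (hasDerivAt_helmholtzDeriv (hyc t) x).deriv]
      field_simp
      ring
    · change g (backFlow V 0 x) = y0 x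
      rw [vel.backFlow_zero]
      exact hgy x (Ioo_subset_Icc_self hx)
    -- The foot of the characteristic is at most `L - (L + η) + 3 * b * T ≤ -(η / 2)`.
    · refine hg0 _ ?_
      have := vel.backFlow_le hl (b := 3 * b) (fun t x => by
        linarith [(abs_le.1 (hw.abs_filteredVelocity_sub_le (l := l) hα hL t x)).1]) hT.le x
      linarith [hx.2]
  · refine c1NormRect_le hT hL hy1 hy2 (fun t _ x _ => hb _) (fun t ht x _ => ?_)
      (fun t ht x _ => ?_)
    · rw [abs_mul, abs_neg, abs_mul]
      exact mul_le_mul (hb' _) (mul_le_mul (vel.abs_le t x) (hE t ht x) (abs_nonneg _)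
        vel.bound_nonneg) (by positivity) hb0
    · rw [abs_mul]
      exact mul_le_mul (hb' _) (hE t ht x) (abs_nonneg _) hb0

theorem mainTheorem4 (T L : ℝ) (hT : 0 < T) (hL : 0 < L) (lam : ℝ → ℝ)
    (hlam_cont : ContinuousOn lam (Set.Icc 0 T))
    (hlam_nonneg : ∀ t ∈ Set.Icc 0 T, 0 ≤ lam t)
    (hlam_int : L < ∫ t in (0 : ℝ)..T, lam t) :
    ∃ δ C : ℝ, 0 < δ ∧ 0 < C ∧
      ∀ y0 : ℝ → ℝ, ContDiffOn ℝ 1 y0 (Set.Icc 0 L) → c1NormInterval L y0 ≤ δ →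
        ∀ α : ℝ, 0 < α →
          ∃ vl vr : ℝ → ℝ,
            ContDiffOn ℝ 1 vl (Set.Icc 0 T) ∧ ContDiffOn ℝ 1 vr (Set.Icc 0 T) ∧
            ∃ y z : ℝ → ℝ → ℝ,
              IsNullControlledState T L α lam y0 vl vr y z ∧
              c1NormRect T L y ≤ C * c1NormInterval L y0 := by
  obtain ⟨η, hη, hint⟩ : ∃ η > 0, L + η = ∫ t in (0 : ℝ)..T, lam t :=
    ⟨_, sub_pos.2 hlam_int, by ring⟩
  obtain ⟨Λ, hΛ⟩ := isCompact_Icc.exists_bound_of_continuousOn hlam_cont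
  have hΛ0 : 0 ≤ Λ := (norm_nonneg _).trans (hΛ 0 (left_mem_Icc.2 hT.le))
  -- Half of the surplus `η` is the room for the cutoff of `g`; the other half absorbs the slowing
  -- effect of `z`.
  obtain ⟨K, hK, hext⟩ := exists_c1_extension hL (half_pos hη)
  set E := Real.exp T with hE
  have hE1 : 1 ≤ E := Real.one_le_exp hT.le
  -- The three summands encode the smallness conditions: images stay `1`-Lipschitz, the map
  -- contracts by `1/2`, and `3 * b * T ≤ η / 2`. All follow from `b * D ≤ 1`, which is what `δ = 1
  -- / (K * D)` ensures.
  set D := E + 6 * E * T + 6 * T / η with hD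
  have hT1 : 0 ≤ 6 * E * T := by positivity
  have hT2 : 0 ≤ 6 * T / η := by positivity
  have hD1 : 1 ≤ D := by linarith
  refine ⟨1 / (K * D), K * (1 + (Λ + 3) * E + E), by positivity, by positivity,
    fun y0 hy0 hδ α hα => ?_⟩
  obtain ⟨g, g', hg, hg', hgy, hg0, hb, hb'⟩ := hext y0 hy0
  set b := K * c1NormInterval L y0 with hbdef
  have hb0 : 0 ≤ b := mul_nonneg hK.le (c1NormInterval_nonneg L y0)
  have hbD : b * D ≤ 1 := by
    rw [le_div_iff₀ (by positivity)] at hδ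
    linarith
  have hbE : b * E ≤ 1 := (mul_le_mul_of_nonneg_left (by linarith) hb0).trans hbD
  have hb1 : b ≤ 1 := (le_mul_of_one_le_right hb0 hD1).trans hbD
  have hbT : b * (6 * E * T) ≤ 1 := (mul_le_mul_of_nonneg_left (by linarith) hb0).trans hbD
  have hbη : b * (6 * T / η) ≤ 1 := (mul_le_mul_of_nonneg_left (by linarith) hb0).trans hbD
  -- Characteristics are defined for all times, so `lam` is extended by its endpoint values.
  have hl : ∀ t ∈ Icc 0 T, lam (clampPoint T t) = lam t := fun t ht => by rw [clampPoint_of_mem ht]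
  obtain ⟨vl, vr, hvl, hvr, y, z, hyz, hn⟩ := exists_isNullControlledState (Λ := Λ) hT hL hα
    (hlam_cont.comp_continuous continuous_clampPoint (clampPoint_mem hT))
    (fun t => hΛ _ (clampPoint_mem hT t)) hl
    (hint.trans (intervalIntegral.integral_congr fun t ht =>
      (hl t (by rwa [uIcc_of_le hT.le] at ht)).symm)).le
    hg hg' hgy hg0 hb hb' hbE (by linarith) (by
      rw [mul_div_assoc', div_le_one hη] at hbη
      linarith)
  refine ⟨vl, vr, hvl, hvr, y, z, hyz, hn.trans ?_⟩
  -- Replacing `b` by `1` in the speed bound makes the estimate linear in the norm of `y0`.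
  have h4 : (Λ + 3 * b) * E ≤ (Λ + 3) * E := by gcongr; linarith
  have h5 := mul_le_mul_of_nonneg_left h4 hb0
  calc b + b * ((Λ + 3 * b) * E) + b * E ≤ b + b * ((Λ + 3) * E) + b * E := by linarith
    _ = K * (1 + (Λ + 3) * E + E) * c1NormInterval L y0 := by rw [hbdef]; ring
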